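/- **Setting.** For $Q\in\mathbb R^{d\times n}$ with columns $g_1,\dots,g_n$ (the generators) and $\mu\in\mathbb R^d$, let $Z(Q,\mu)=A_{Q,\mu}([0,1]^n)$, where $A_{Q,\mu}(t)=Qt+\mu$. The space of zonotopes $\mathcal Z_n(\mathbb R^d)$ is the space of all pairs $(Q,\mu)$ modulo permutations of the columns of $Q$, with the quotient topology. A zonotope is in *general position* if any at most $d$ of its generators are linearly independent. For a (nonempty) polytope $K\subset\mathbb R^d$ write $\mathrm{Vert}(K)$ for its vertex set and $\Pi(x,K)$ for the point of $K$ nearest to $x$. A point $x$ is *Hausdorff stable relative to $K$* if $x\in\operatorname{int}K$ or $x-\Pi(x,K)$ lies in the relative interior of the normal cone of $K$ at $\Pi(x,K)$. For a fixed polytope $P$ let $d_P(Z)$ be the Hausdorff distance between $P$ and $Z$. Let $d(x,W)$ denote the distance from a point $x$ to an affine subspace $W$ and $\mathrm{Aff}(X)$ the affine hull of $X$. For $Z_0=Z(Q_0,\mu_0)$ put $\mathrm{Lift}(q)=A_{Q_0,\mu_0}^{-1}(q)\cap[0,1]^n$. When $\mathrm{Lift}(q)$ is a single point for every $q\in\partial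 Z_0$, the *pushforward* to $Z=Z(Q,\mu)$ is $\varphi_Z(q)=A_{Q,\mu}(\mathrm{Lift}(q))$, $q\in\partial Z_0$. For a face $F$ of $Z_0$ put $\varphi_Z(F)=A_{Q,\mu}\bigl(\bigcup_{q\in F}\mathrm{Lift}(q)\bigr)$; in particular $\varphi_Z(Z_0)=Z$. **Theorem.** Let $P\subset\mathbb R^d$ be a polytope and $Z_0=Z(Q_0,\mu_0)\in\mathcal Z_n(\mathbb R^d)$ a zonotope in general position such that every vertex of $P$ is Hausdorff stable relative to $Z_0$ and every vertex of $Z_0$ is Hausdorff stable relative to $P$. For $p\in\mathrm{Vert}(P)$ let $F_p$ be the smallest face of $Z_0$ containing $\Pi(p,Z_0)$, and for $q\in\mathrm{Vert}(Z_0)$ let $F_q$ be the smallest face of $P$ containing $\Pi(q,P)$ (a polytope is a face of itself). Then there is an open neighborhood $U$ of $Z_0$ in $\mathcal Z_n(\mathbb R^d)$, the image of an open neighborhood $V$ of $(Q_0,\mu_0)$ in the space of parameters, such that the following hold, where $Z\in U$ is represented by $(Q,\mu)\in V$. 1. $\mathrm{Lift}(q)$ is a single point for each $q\in\partial Z_0$,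 and for each $Z\in U$ the pushforward $\varphi_Z$ maps $\partial Z_0$ into $\partial Z$ and does not depend on the choice of $(Q,\mu)\in V$ representing $Z$. 2. For all $Z\in U$, $$d_P(Z)=\max\Bigl(\max_{p\in\mathrm{Vert}(P)}d\bigl(p,\mathrm{Aff}(\varphi_Z(F_p))\bigr),\ \max_{q\in\mathrm{Vert}(Z_0)}d\bigl(\varphi_Z(q),\mathrm{Aff}(F_q)\bigr)\Bigr).$$ 3. Each term of this maximum is on $V$ the square root of a bounded nonnegative rational function of the entries of $(Q,\mu)$ whose denominator has no zero in $V$. 4. The term of $p\in\mathrm{Vert}(P)$ is a differentiable function of $(Q,\mu)\in V$, except possibly when $\operatorname{int}Z_0=\emptyset$ and $p\in Z_0$; the term of $q\in\mathrm{Vert}(Z_0)$ is a differentiable function of $(Q,\mu)\in V$, except possibly when $\operatorname{int}P=\emptyset$ and $q\in P$. In particular all terms are differentiable on $V$ if $P$ and $Z_0$ are full-dimensional. -/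

import Mathlib

namespace ZonotopeHausdorff

/-- Euclidean space of dimension `d`. -/
abbrev Euc (d : ℕ) : Type := EuclideanSpace ℝ (Fin d)

/-! ### Polytopes, faces, projections, Hausdorff stability -/

/-- A polytope: the convex hull of a nonempty finite set of points. -/
def IsPolytope {d : ℕ} (K : Set (Euc d)) : Prop :=
  ∃ S : Set (Euc d), S.Finite ∧ S.Nonempty ∧ K = convexHull ℝ S

/-- The vertices of a polytope. -/
def vert {d : ℕ} (K : Set (Euc d)) : Set (Euc d) := Set.extremePoints ℝ K

/-- The smallest face of the polytope `K` containing the point `y ∈ K`. The nonempty sets `F` with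
`IsExposed ℝ K F` are the nonempty faces of `K`, with `K` itself among them. -/
def minFace {d : ℕ} (K : Set (Euc d)) (y : Euc d) : Set (Euc d) :=
  ⋂₀ {F | IsExposed ℝ K F ∧ y ∈ F}

/-- `proj K y` is the point of `K` that is closest to `y` (it exists and is unique when `K` is
nonempty, closed and convex, for example a polytope). -/
noncomputable def proj {d : ℕ} (K : Set (Euc d)) (y : Euc d) : Euc d :=
  Classical.epsilon fun w => w ∈ K ∧ ∀ z ∈ K, dist y w ≤ dist y z

/-- The smallest face of `K` containing the projection of `y` onto `K`. -/
noncomputable def projFace {d : ℕ} (K : Set (Euc d)) (y : Euc d) : Set (Euc d) :=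
  minFace K (proj K y)

/-- The normal cone to `K` at `y`, with its apex at the origin. -/
def normalCone {d : ℕ} (K : Set (Euc d)) (y : Euc d) : Set (Euc d) :=
  {v | ∀ z ∈ K, inner ℝ v (z - y) ≤ 0}

/-- `y` is Hausdorff stable relative to `K`: it is an interior point of `K`, or it lies in the
relative interior of the normal cone attached to `K` at the projection of `y`. -/
def HausdorffStable {d : ℕ} (K : Set (Euc d)) (y : Euc d) : Prop :=
  y ∈ interior K ∨ y - proj K y ∈ intrinsicInterior ℝ (normalCone K (proj K y))

/-- The distance from a point to the affine hull of a set. -/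
noncomputable def distAff {d : ℕ} (y : Euc d) (F : Set (Euc d)) : ℝ :=
  Metric.infDist y (affineSpan ℝ F : Set (Euc d))

/-! ### The space of zonotopes -/

/-- Parameters `(Q, μ)` of a zonotope in `ℝ ^ d` with `n` generators: the `n` columns of the
matrix `Q`, which are the generators, and the translation vector `μ`. -/
abbrev Param (n d : ℕ) : Type := (Fin n → Euc d) × Euc d

/-- The affine map `t ↦ Q t + μ`. -/
noncomputable def affMap {n d : ℕ} (x : Param n d) (t : Fin n → ℝ) : Euc d :=
  ∑ i, t i • x.1 i + x.2

/-- The unit cube. -/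
def cube (n : ℕ) : Set (Fin n → ℝ) := Set.Icc 0 1

/-- The zonotope `Z(Q, μ)`, the image of the unit cube. -/
def zonotope {n d : ℕ} (x : Param n d) : Set (Euc d) := affMap x '' cube n

/-- The action of the symmetric group on the parameters identifies `(Q, μ)` with `(Q', μ)` when
the columns of `Q'` are a permutation of those of `Q`. -/
def permSetoid (n d : ℕ) : Setoid (Param n d) where
  r x y := ∃ σ : Equiv.Perm (Fin n), y = (x.1 ∘ σ, x.2)
  iseqv :=
    { refl := fun x => ⟨Equiv.refl _, rfl⟩
      symm := by
        rintro x y ⟨σ, rfl⟩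
        refine ⟨σ.symm, ?_⟩
        ext1
        · funext i
          simp
        · rfl
      trans := by
        rintro x y z ⟨σ, rfl⟩ ⟨τ, rfl⟩
        exact ⟨τ.trans σ, rfl⟩ }

/-- The space of zonotopes: parameters modulo permutations of the generators. -/
def ZonotopeSpace (n d : ℕ) : Type := Quotient (permSetoid n d)

/-- The quotient topology on the space of zonotopes. -/
instance (n d : ℕ) : TopologicalSpace (ZonotopeSpace n d) :=
  inferInstanceAs (TopologicalSpace (Quotient (permSetoid n d)))

/-- The point of the space of zonotopes given by the parameters `x`. -/
def ZonotopeSpace.mk {n d : ℕ} (x : Param n d) : ZonotopeSpace n d :=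
  Quotient.mk (permSetoid n d) x

lemma zonotope_comp_perm_subset {n d : ℕ} (x : Param n d) (σ : Equiv.Perm (Fin n)) :
    zonotope x ⊆ zonotope (x.1 ∘ σ, x.2) := by
  rintro _ ⟨t, ht, rfl⟩
  refine ⟨t ∘ σ, ⟨fun i => ht.1 (σ i), fun i => ht.2 (σ i)⟩, ?_⟩
  simp only [affMap, Function.comp_apply]
  rw [Equiv.sum_comp σ (fun i => t i • x.1 i)]

lemma zonotope_eq_of_rel {n d : ℕ} {x y : Param n d} (h : (permSetoid n d).r x y) :
    zonotope x = zonotope y := by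
  apply Set.Subset.antisymm
  · obtain ⟨σ, rfl⟩ := h
    exact zonotope_comp_perm_subset x σ
  · obtain ⟨σ, rfl⟩ := (permSetoid n d).iseqv.symm h
    exact zonotope_comp_perm_subset y σ

/-- The zonotope, as a set of points, that corresponds to a point of the space of zonotopes. -/
def ZonotopeSpace.toSet {n d : ℕ} (Z : ZonotopeSpace n d) : Set (Euc d) :=
  Quotient.lift zonotope (fun _ _ h => zonotope_eq_of_rel h) Z

/-- The function `d_P` on the space of zonotopes: the Hausdorff distance to `P`. -/
noncomputable def hausdorffTo {n d : ℕ} (P : Set (Euc d)) (Z : ZonotopeSpace n d) : ℝ :=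
  Metric.hausdorffDist P Z.toSet

/-- The generators are in general position: any at most `d` of them are linearly independent. -/
def GeneralPosition {n d : ℕ} (x : Param n d) : Prop :=
  ∀ s : Finset (Fin n), s.card ≤ d → LinearIndependent ℝ (fun i : s => x.1 i)

/-- The locality conditions on the polytope `P` and the zonotope with parameters `x`. -/
structure LocalityConditions {n d : ℕ} (P : Set (Euc d)) (x : Param n d) : Prop where
  generalPosition : GeneralPosition x
  stable_left : ∀ p ∈ vert P, HausdorffStable (zonotope x) p
  stable_right : ∀ q ∈ vert (zonotope x), HausdorffStable P q

/-! ### Lifts and the pushforward -/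

/-- The points of the unit cube that are mapped to the point `q`. -/
def lift {n d : ℕ} (x : Param n d) (q : Euc d) : Set (Fin n → ℝ) :=
  {t | t ∈ cube n ∧ affMap x t = q}

/-- A point is stable if its lift is a single point. -/
def StablePoint {n d : ℕ} (x : Param n d) (q : Euc d) : Prop := ∃ t, lift x q = {t}

/-- The pushforward `φ_Z` from the zonotope with parameters `x₀` to the zonotope `Z` with
parameters `x`, at a stable point `q` of the boundary of the former. -/
noncomputable def pushforward {n d : ℕ} (x₀ x : Param n d) (q : Euc d) : Euc d :=
  affMap x (Classical.epsilon fun t => t ∈ lift x₀ q)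

/-- The pushforward `φ_Z(F)` of a set `F`: the image of all lifts of its points. If all points
of `F` are stable, this is the image of `F` under `pushforward x₀ x`; the pushforward of the whole
zonotope with parameters `x₀` is the whole zonotope with parameters `x`. -/
def pushforwardSet {n d : ℕ} (x₀ x : Param n d) (F : Set (Euc d)) : Set (Euc d) :=
  affMap x '' ⋃ q ∈ F, lift x₀ q

/-! ### The terms of the maximum -/

/-- The term `d(p, Aff(φ_Z(F_p)))` of a vertex `p` of `P`, as a function of the parameters `x`
of `Z`; here `F_p` is the smallest face of `Z₀` containing the projection of `p` onto `Z₀`. -/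
noncomputable def termOfP {n d : ℕ} (x₀ : Param n d) (p : Euc d) (x : Param n d) : ℝ :=
  distAff p (pushforwardSet x₀ x (projFace (zonotope x₀) p))

/-- The term `d(φ_Z(q), Aff(F_q))` of a vertex `q` of `Z₀`, as a function of the parameters `x`
of `Z`; here `F_q` is the smallest face of `P` containing the projection of `q` onto `P`. -/
noncomputable def termOfZ {n d : ℕ} (P : Set (Euc d)) (x₀ : Param n d) (q : Euc d)
    (x : Param n d) : ℝ :=
  distAff (pushforward x₀ x q) (projFace P q)

/-- The real coordinates of a parameter: the entries of `Q` and the entries of `μ`. -/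
def coords {n d : ℕ} (x : Param n d) : (Fin n × Fin d) ⊕ Fin d → ℝ :=
  Sum.elim (fun ij => x.1 ij.1 ij.2) (fun j => x.2 j)

/-- On `V` the function `f` is the square root of a bounded (nonnegative) rational function of
the parameters, whose denominator has no zero in `V`. -/
def IsSqrtOfBoundedRational {n d : ℕ} (f : Param n d → ℝ) (V : Set (Param n d)) : Prop :=
  ∃ (N D : MvPolynomial ((Fin n × Fin d) ⊕ Fin d) ℝ) (C : ℝ), ∀ x ∈ V,
    MvPolynomial.eval (coords x) D ≠ 0 ∧
    0 ≤ MvPolynomial.eval (coords x) N / MvPolynomial.eval (coords x) D ∧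
    MvPolynomial.eval (coords x) N / MvPolynomial.eval (coords x) D ≤ C ∧
    f x = √(MvPolynomial.eval (coords x) N / MvPolynomial.eval (coords x) D)

end ZonotopeHausdorff

open ZonotopeHausdorff

open Filter Topology

namespace ZonotopeHausdorff

/-! ### Convexity and nearest points in inner product spaces -/

section InnerProductSpace

variable {E : Type*} [NormedAddCommGroup E] [InnerProductSpace ℝ E]

/-! The Hausdorff distance of two convex hulls of finite sets is attained at one of the generating
points, since closed thickenings of convex sets are convex (`isGreatest_hausdorffDist`). So only
finitely many point-to-body distances have to be followed near `x₀`, and for each of them it must be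
seen that the nearest point stays in one fixed face.

Stability provides this. A vector in the relative interior of the normal cone at a point exposes a
face with that point in its relative interior (`eventually_add_mem_face`). After a small
perturbation the foot of the perpendicular on the affine hull of the face therefore still lies in
the face, and the strict inequalities at the generating points off the face persist, so the foot is
the nearest point of the whole body (`HausdorffStable.exists_infDist_eq`). For interior points both
distances are simply zero.

For zonotopes, faces are encoded by the signs of the inner products of a normal with the generators
(`Compat`, `StrictCompat`). In general position the generators orthogonal to a nonzero vector are
independent (`GeneralPosition.linearIndependent`). Hence lifts of boundary points are unique, sign
patterns survive perturbation, and the foot argument works with moving generators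
(`GeneralPosition.exists_infDist_eq`). By compactness of the sphere of directions, the pushforwards
of the vertices of `Z₀` span every nearby zonotope (`GeneralPosition.eventually_zonotope_subset`).

The foot is computed from the Gram matrix, so the squared distance is rational with the Gram
determinant as denominator. Its root is differentiable where it is nonzero; a term that vanishes at
`x₀` is locally zero when the body is full-dimensional. Independence of the representative holds
because permutations relating parameters close to `x₀` must fix `x₀`, hence its unique lifts. -/

/-- A point with an obtuse angle towards every other point of `K` is the nearest point of `K`. -/
lemma infDist_eq_of_inner_nonpos {K : Set E} {p y : E} (hy : y ∈ K)
    (h : ∀ z ∈ K, inner ℝ (p - y) (z - y) ≤ 0) : Metric.infDist p K = ‖p - y‖ := by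
  apply le_antisymm
  · rw [← dist_eq_norm]
    exact Metric.infDist_le_dist_of_mem hy
  · rw [Metric.le_infDist ⟨y, hy⟩]
    intro z hz
    rw [dist_eq_norm]
    have h1 := norm_sub_sq_real (p - y) (z - y)
    rw [sub_sub_sub_cancel_right] at h1
    have h2 := h z hz
    apply le_of_sq_le_sq _ (norm_nonneg _)
    nlinarith [sq_nonneg ‖z - y‖]

/-- A linear functional that is constant on a set is constant on the affine span of the set. -/
lemma inner_eq_of_mem_affineSpan {F : Set E} {v : E} {a : ℝ} (h : ∀ z ∈ F, inner ℝ v z = a) {z : E}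
    (hz : z ∈ affineSpan ℝ F) : inner ℝ v z = a := by
  refine affineSpan_induction (p := fun z => inner ℝ v z = a) hz h fun c p q r hp hq hr => ?_
  simp [inner_add_right, inner_smul_right, inner_sub_right, hp, hq, hr]

/-- The distance to an affine span is attained at a point with orthogonal difference vector. -/
lemma infDist_affineSpan_eq {F : Set E} {p y : E} (hy : y ∈ affineSpan ℝ F)
    (h : ∀ z ∈ F, inner ℝ (p - y) (z - y) = 0) :
    Metric.infDist p (affineSpan ℝ F : Set E) = ‖p - y‖ := by
  refine infDist_eq_of_inner_nonpos hy fun z hz => ?_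
  have h' : ∀ z ∈ F, inner ℝ (p - y) z = inner ℝ (p - y) y := fun z hz => by
    have := h z hz
    rwa [inner_sub_right, sub_eq_zero] at this
  rw [inner_sub_right, inner_eq_of_mem_affineSpan h' hz, sub_self]

/-- The segment from a point of a set to a relative interior point may be prolonged a bit. -/
lemma exists_add_smul_mem_of_mem_intrinsicInterior {N : Set E} {v u : E}
    (hv : v ∈ intrinsicInterior ℝ N) (hu : u ∈ N) : ∃ ε : ℝ, 0 < ε ∧ v + ε • (v - u) ∈ N := by
  obtain ⟨v', hv', rfl⟩ := hv
  have hu' : u ∈ affineSpan ℝ N := subset_affineSpan ℝ N hu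
  let f : ℝ → affineSpan ℝ N := fun ε =>
    ⟨AffineMap.lineMap (v' : E) u (-ε), AffineMap.lineMap_mem _ v'.2 hu'⟩
  have hf : Continuous f := by
    apply Continuous.subtype_mk
    exact AffineMap.lineMap_continuous.comp continuous_neg
  have h0 : f 0 = v' := by ext; simp [f]
  have h1 : ∀ᶠ ε in 𝓝 (0 : ℝ), f ε ∈ ((↑) ⁻¹' N : Set (affineSpan ℝ N)) := by
    have h2 := hf.tendsto 0
    rw [h0] at h2
    exact h2 (mem_interior_iff_mem_nhds.1 hv')
  have h3 : ∀ᶠ ε in 𝓝[>] (0 : ℝ), f ε ∈ ((↑) ⁻¹' N : Set (affineSpan ℝ N)) :=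
    h1.filter_mono nhdsWithin_le_nhds
  obtain ⟨ε, h4, h5⟩ := (h3.and self_mem_nhdsWithin).exists
  refine ⟨ε, h5, ?_⟩
  have h6 : (f ε : E) ∈ N := h4
  convert h6 using 1
  simp only [f, AffineMap.lineMap_apply, vsub_eq_sub, vadd_eq_add]
  module

/-- A point outside of a closed convex set is separated from it by a vector. -/
lemma exists_inner_lt_of_notMem [CompleteSpace E] {K : Set E} (hK : Convex ℝ K) (hc : IsClosed K)
    {p : E} (hp : p ∉ K) : ∃ u : E, ∀ z ∈ K, inner ℝ u z < inner ℝ u p := by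
  obtain ⟨f, a, h1, h2⟩ := geometric_hahn_banach_closed_point hK hc hp
  refine ⟨(InnerProductSpace.toDual ℝ E).symm f, fun z hz => ?_⟩
  simp only [InnerProductSpace.toDual_symm_apply]
  exact (h1 z hz).trans h2

/-- The closed `r`-thickening of a convex set is convex, so it contains the hull of any of its
subsets. -/
lemma infDist_le_of_mem_convexHull {K S : Set E} (hK : Convex ℝ K) (hne : K.Nonempty) {r : ℝ}
    (h : ∀ z ∈ S, Metric.infDist z K ≤ r) {z : E} (hz : z ∈ convexHull ℝ S) :
    Metric.infDist z K ≤ r := by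
  have hr : 0 ≤ r := by
    obtain ⟨s, hs⟩ := convexHull_nonempty_iff.1 ⟨z, hz⟩
    exact Metric.infDist_nonneg.trans (h s hs)
  have key : ∀ z, Metric.infDist z K ≤ r ↔ z ∈ Metric.cthickening r K := fun z => by
    rw [Metric.mem_cthickening_iff, Metric.infDist,
      ENNReal.le_ofReal_iff_toReal_le (Metric.infEDist_ne_top hne) hr]
  rw [key]
  exact convexHull_min (fun z hz => (key z).1 (h z hz)) (hK.cthickening r) hz

/-! ### Orthogonal projection by means of the Gram matrix -/

section Gram

lemma continuous_gram {ι X : Type*} [TopologicalSpace X] {b : X → ι → E} (hb : Continuous b) :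
    Continuous fun x => Matrix.gram ℝ (b x) := by
  refine continuous_matrix fun i j => ?_
  simp only [Matrix.gram_apply]
  fun_prop

variable {ι : Type*} [Fintype ι] [DecidableEq ι]

/-- The coefficients of the orthogonal projection of `w` onto the span of the family `b`. -/
noncomputable def gramCoeff (b : ι → E) (w : E) : ι → ℝ :=
  (Matrix.gram ℝ b).det⁻¹ • ((Matrix.gram ℝ b).adjugate.mulVec fun i => inner ℝ (b i) w)

/-- The component of `w` that is orthogonal to the span of the family `b`. -/
noncomputable def residual (b : ι → E) (w : E) : E := w - ∑ i, gramCoeff b w i • b i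

/-- The adjugate identity shows that `gramCoeff` solves the normal equations. -/
lemma inner_residual {b : ι → E} (hb : (Matrix.gram ℝ b).det ≠ 0) (w : E) (j : ι) :
    inner ℝ (residual b w) (b j) = 0 := by
  have h : (Matrix.gram ℝ b).mulVec (gramCoeff b w) = fun i => inner ℝ (b i) w := by
    rw [gramCoeff, Matrix.mulVec_smul, Matrix.mulVec_mulVec, Matrix.mul_adjugate,
      Matrix.smul_mulVec, Matrix.one_mulVec, smul_smul, inv_mul_cancel₀ hb, one_smul]
  have hj := congrFun h j
  simp only [Matrix.mulVec, dotProduct, Matrix.gram_apply] at hj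
  rw [real_inner_comm, residual, inner_sub_right, inner_sum, ← hj, sub_eq_zero]
  refine Finset.sum_congr rfl fun i _ => ?_
  rw [inner_smul_right, mul_comm]

lemma gramCoeff_eq_zero {b : ι → E} {w : E} (h : ∀ i, inner ℝ (b i) w = 0) : gramCoeff b w = 0 := by
  have : (fun i => inner ℝ (b i) w) = 0 := funext h
  rw [gramCoeff, this, Matrix.mulVec_zero, smul_zero]

lemma residual_eq_self {b : ι → E} {w : E} (h : ∀ i, inner ℝ (b i) w = 0) : residual b w = w := by
  simp [residual, gramCoeff_eq_zero h]

/-- By orthogonality the squared norm equals the inner product of the residual with `w`. Written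
with the adjugate, it has the Gram determinant as its only denominator. -/
lemma norm_residual_sq {b : ι → E} (hb : (Matrix.gram ℝ b).det ≠ 0) (w : E) :
    ‖residual b w‖ ^ 2 = ((Matrix.gram ℝ b).det * inner ℝ w w -
      ∑ i, ((Matrix.gram ℝ b).adjugate.mulVec fun i => inner ℝ (b i) w) i * inner ℝ (b i) w) /
        (Matrix.gram ℝ b).det := by
  have h1 : ‖residual b w‖ ^ 2 = inner ℝ (residual b w) w := by
    rw [← real_inner_self_eq_norm_sq]
    nth_rewrite 2 [residual]
    rw [inner_sub_right, inner_sum]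
    simp [inner_smul_right, inner_residual hb]
  rw [h1, residual, inner_sub_left, sum_inner, eq_div_iff hb, sub_mul, mul_comm, Finset.sum_mul]
  congr 1
  refine Finset.sum_congr rfl fun i _ => ?_
  rw [inner_smul_left, gramCoeff, Pi.smul_apply, smul_eq_mul, conj_trivial]
  field_simp

variable {X : Type*} [TopologicalSpace X] {b : X → ι → E} {w : X → E}

lemma eventually_det_gram_ne_zero (hb : Continuous b) {x₀ : X}
    (h : (Matrix.gram ℝ (b x₀)).det ≠ 0) : ∀ᶠ x in 𝓝 x₀, (Matrix.gram ℝ (b x)).det ≠ 0 :=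
  (continuous_gram hb).matrix_det.continuousAt.eventually_ne h

lemma continuousAt_gramCoeff (hb : Continuous b) (hw : Continuous w) {x₀ : X}
    (h : (Matrix.gram ℝ (b x₀)).det ≠ 0) : ContinuousAt (fun x => gramCoeff (b x) (w x)) x₀ := by
  refine ContinuousAt.smul (f := fun x => (Matrix.gram ℝ (b x)).det⁻¹) ?_ ?_
  · exact (continuous_gram hb).matrix_det.continuousAt.inv₀ h
  · apply Continuous.continuousAt
    apply (continuous_gram hb).matrix_adjugate.matrix_mulVec
    fun_prop

lemma continuousAt_residual (hb : Continuous b) (hw : Continuous w) {x₀ : X}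
    (h : (Matrix.gram ℝ (b x₀)).det ≠ 0) : ContinuousAt (fun x => residual (b x) (w x)) x₀ := by
  apply hw.continuousAt.sub
  have h1 := continuousAt_gramCoeff hb hw h
  refine tendsto_finsetSum _ fun i _ => ?_
  exact ((continuousAt_pi.1 h1) i).smul ((continuous_apply i).comp hb).continuousAt

/-- A linearly independent family admits vectors with prescribed inner products. -/
lemma exists_inner_eq {b : ι → E} (hb : LinearIndependent ℝ b) (a : ι → ℝ) :
    ∃ w : E, ∀ i, inner ℝ w (b i) = a i := by
  have hd := Matrix.det_gram_ne_zero_iff_linearIndependent.2 hb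
  refine ⟨∑ i, ((Matrix.gram ℝ b)⁻¹.mulVec a) i • b i, fun j => ?_⟩
  have h : (Matrix.gram ℝ b).mulVec ((Matrix.gram ℝ b)⁻¹.mulVec a) = a := by
    rw [Matrix.mulVec_mulVec, Matrix.mul_nonsing_inv _ (isUnit_iff_ne_zero.2 hd), Matrix.one_mulVec]
  have hj := congrFun h j
  simp only [Matrix.mulVec, dotProduct, Matrix.gram_apply] at hj
  rw [← hj, sum_inner]
  refine Finset.sum_congr rfl fun i _ => ?_
  rw [inner_smul_left, real_inner_comm, mul_comm]
  simp [Matrix.mulVec, dotProduct]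

end Gram

end InnerProductSpace

/-! ### Square roots of rational functions of the parameters -/

variable {n d : ℕ}

lemma differentiable_eval_coords (N : MvPolynomial ((Fin n × Fin d) ⊕ Fin d) ℝ) :
    Differentiable ℝ fun x : Param n d => MvPolynomial.eval (coords x) N := by
  induction N using MvPolynomial.induction_on with
  | C a => simp
  | add p q hp hq => simpa only [map_add] using hp.fun_add hq
  | mul_X p i hp =>
    simp only [map_mul, MvPolynomial.eval_X]
    apply hp.mul
    rcases i with ⟨i, j⟩ | j <;> simp only [coords, Sum.elim_inl, Sum.elim_inr] <;> fun_prop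

/-- The regularity of a nonnegative function whose square is locally a rational function. -/
lemma regular_of_sq_eq_rational {f : Param n d → ℝ} {x₀ : Param n d}
    {N D : MvPolynomial ((Fin n × Fin d) ⊕ Fin d) ℝ}
    (h : ∀ᶠ x in 𝓝 x₀, MvPolynomial.eval (coords x) D ≠ 0 ∧ 0 ≤ f x ∧
      f x ^ 2 = MvPolynomial.eval (coords x) N / MvPolynomial.eval (coords x) D) :
    (∀ᶠ V in (𝓝 x₀).smallSets, IsSqrtOfBoundedRational f V) ∧
      (f x₀ ≠ 0 → ∀ᶠ V in (𝓝 x₀).smallSets, DifferentiableOn ℝ f V) := by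
  have hN := differentiable_eval_coords N
  have hD := differentiable_eval_coords D
  have hx₀ := h.self_of_nhds
  have hcont : ContinuousAt (fun x : Param n d =>
      MvPolynomial.eval (coords x) N / MvPolynomial.eval (coords x) D) x₀ :=
    hN.continuous.continuousAt.div hD.continuous.continuousAt hx₀.1
  constructor
  · have hC := hcont.eventually_lt continuousAt_const (hx₀.2.2.symm.trans_lt (lt_add_one (f x₀ ^ 2)))
    refine eventually_smallSets.2 ⟨_, h.and hC, fun V hV => ⟨N, D, f x₀ ^ 2 + 1, fun x hx => ?_⟩⟩
    obtain ⟨⟨h1, h2, h3⟩, h4⟩ := hV hx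
    refine ⟨h1, ?_, h4.le, ?_⟩
    · rw [← h3]
      positivity
    · rw [← h3, Real.sqrt_sq h2]
  · intro hf
    -- The square root is differentiable only away from zero. The identity is also needed around
    -- each point of `V`, not only at it, to transfer the derivative.
    have hne := hcont.eventually_ne (hx₀.2.2.symm.trans_ne (pow_ne_zero 2 hf))
    refine eventually_smallSets.2 ⟨_, h.eventually_nhds.and hne, fun V hV x hx => ?_⟩
    obtain ⟨h1, h2⟩ := hV hx
    have h3 := h1.self_of_nhds
    apply DifferentiableAt.differentiableWithinAt
    have h4 : DifferentiableAt ℝ (fun x : Param n d =>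
        MvPolynomial.eval (coords x) N / MvPolynomial.eval (coords x) D) x := by
      simp only [div_eq_mul_inv]
      exact (hN x).fun_mul ((hD x).fun_inv h3.1)
    replace h4 := h4.sqrt h2
    refine h4.congr_of_eventuallyEq ?_
    filter_upwards [h1] with z hz
    rw [← hz.2.2, Real.sqrt_sq hz.2.1]

/-- The norm of the residual of a polynomial family of vectors is the square root of a rational
function. -/
lemma exists_rational_norm_residual_sq {ι : Type*} [Fintype ι] [DecidableEq ι]
    {b : Param n d → ι → Euc d} {w : Param n d → Euc d}
    (bP : ι → Fin d → MvPolynomial ((Fin n × Fin d) ⊕ Fin d) ℝ)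
    (wP : Fin d → MvPolynomial ((Fin n × Fin d) ⊕ Fin d) ℝ)
    (hb : ∀ x i k, MvPolynomial.eval (coords x) (bP i k) = b x i k)
    (hw : ∀ x k, MvPolynomial.eval (coords x) (wP k) = w x k) :
    ∃ N D : MvPolynomial ((Fin n × Fin d) ⊕ Fin d) ℝ,
      ∀ x, (Matrix.gram ℝ (b x)).det ≠ 0 → MvPolynomial.eval (coords x) D ≠ 0 ∧
        ‖residual (b x) (w x)‖ ^ 2 =
          MvPolynomial.eval (coords x) N / MvPolynomial.eval (coords x) D := by
  let M : Matrix ι ι (MvPolynomial ((Fin n × Fin d) ⊕ Fin d) ℝ) :=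
    Matrix.of fun i j => ∑ k, bP i k * bP j k
  let β : ι → MvPolynomial ((Fin n × Fin d) ⊕ Fin d) ℝ := fun i => ∑ k, bP i k * wP k
  have hM : ∀ x, (MvPolynomial.eval (coords x)).mapMatrix M = Matrix.gram ℝ (b x) := fun x => by
    ext i j
    simp [M, Matrix.gram_apply, PiLp.inner_apply, hb, mul_comm]
  have hβ : ∀ x i, MvPolynomial.eval (coords x) (β i) = inner ℝ (b x i) (w x) := fun x i => by
    simp [β, PiLp.inner_apply, hb, hw, mul_comm]
  have hww : ∀ x, MvPolynomial.eval (coords x) (∑ k, wP k * wP k) = inner ℝ (w x) (w x) :=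
    fun x => by
    simp only [map_sum, map_mul, PiLp.inner_apply, hw]
    simp [sq]
  have hdet : ∀ x, MvPolynomial.eval (coords x) M.det = (Matrix.gram ℝ (b x)).det := fun x => by
    rw [RingHom.map_det, hM]
  have hadj : ∀ x i j, MvPolynomial.eval (coords x) (M.adjugate i j) =
      (Matrix.gram ℝ (b x)).adjugate i j := fun x i j => by
    rw [← hM, ← RingHom.map_adjugate, RingHom.mapMatrix_apply, Matrix.map_apply]
  refine ⟨M.det * (∑ k, wP k * wP k) - ∑ i, (M.adjugate.mulVec β) i * β i, M.det, fun x hx => ?_⟩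
  rw [hdet]
  refine ⟨hx, ?_⟩
  rw [norm_residual_sq hx, map_sub, map_mul, hdet, hww, map_sum]
  simp only [map_mul, hβ, Matrix.mulVec, dotProduct, map_sum, hadj]

/-! ### Faces of convex sets -/

lemma minFace_eq {K F : Set (Euc d)} {y : Euc d} (hF : IsExposed ℝ K F) (hy : y ∈ F)
    (h : ∀ B, IsExposed ℝ K B → y ∈ B → F ⊆ B) : minFace K y = F :=
  Set.Subset.antisymm (Set.sInter_subset_of_mem ⟨hF, hy⟩)
    (Set.subset_sInter fun B hB => h B hB.1 hB.2)

/-- A normal vector is maximal at `y`, so it exposes this face itself. The case `v = 0` is allowed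
and gives all of `K`. -/
lemma isExposed_setOf_inner_eq_zero {K : Set (Euc d)} {v y : Euc d} (hy : y ∈ K)
    (h : v ∈ normalCone K y) : IsExposed ℝ K {z ∈ K | inner ℝ v (z - y) = 0} := by
  intro _
  refine ⟨innerSL ℝ v, Set.ext fun z => and_congr_right fun hz => ?_⟩
  simp only [innerSL_apply_apply]
  have h' : ∀ z ∈ K, inner ℝ v z ≤ inner ℝ v y := fun z hz => by
    have := h z hz
    rwa [inner_sub_right, sub_nonpos] at this
  rw [inner_sub_right, sub_eq_zero]
  exact ⟨fun h0 w hw => h0 ▸ h' w hw, fun h0 => le_antisymm (h' z hz) (h0 y hy)⟩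

/-- A linear functional with a maximum at an interior point vanishes. -/
lemma eq_zero_of_isMax_of_mem_interior {K : Set (Euc d)} {u y : Euc d} (hy : y ∈ interior K)
    (h : ∀ z ∈ K, inner ℝ u z ≤ inner ℝ u y) : u = 0 := by
  have h1 : Tendsto (fun ε : ℝ => y + ε • u) (𝓝 0) (𝓝 y) := by
    have : Continuous fun ε : ℝ => y + ε • u := by fun_prop
    simpa using this.tendsto 0
  have h2 : ∀ᶠ ε in 𝓝[>] (0 : ℝ), y + ε • u ∈ K :=
    (h1.eventually (mem_interior_iff_mem_nhds.1 hy)).filter_mono nhdsWithin_le_nhds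
  obtain ⟨ε, h3, h4⟩ := (h2.and self_mem_nhdsWithin).exists
  have h5 := h _ h3
  rw [inner_add_right, inner_smul_right] at h5
  have h6 : (0 : ℝ) < ε := h4
  by_contra h7
  nlinarith [mul_pos h6 (real_inner_self_pos.2 h7)]

lemma minFace_of_mem_interior {K : Set (Euc d)} {y : Euc d} (hy : y ∈ interior K) :
    minFace K y = K := by
  refine minFace_eq (IsExposed.refl K) (interior_subset hy) fun B hB hyB z hz => ?_
  obtain ⟨l, rfl⟩ := hB ⟨y, hyB⟩
  have h0 : (InnerProductSpace.toDual ℝ (Euc d)).symm l = 0 :=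
    eq_zero_of_isMax_of_mem_interior hy fun z hz => by
      simpa only [InnerProductSpace.toDual_symm_apply] using hyB.2 z hz
  have hl : l = 0 := by simpa using h0
  exact ⟨hz, fun w _ => by simp [hl]⟩

/-- A face with `y` in its relative interior is the smallest face that contains `y`. -/
lemma minFace_eq_of_eventually {K F : Set (Euc d)} {y : Euc d} {W : Submodule ℝ (Euc d)}
    (hF : IsExposed ℝ K F) (hW : ∀ z ∈ F, z - y ∈ W)
    (h : ∀ᶠ w in 𝓝 (0 : Euc d), w ∈ W → y + w ∈ F) : minFace K y = F := by
  have hy : y ∈ F := by simpa using h.self_of_nhds W.zero_mem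
  refine minFace_eq hF hy fun B hB hyB z hz => ?_
  obtain ⟨l, rfl⟩ := hB ⟨y, hyB⟩
  -- Step from `y` away from `z`, remaining in `F`: a functional maximal at `y` cannot then be
  -- smaller at `z`.
  have h1 : Tendsto (fun ε : ℝ => -(ε • (z - y))) (𝓝 0) (𝓝 0) := by
    have : Continuous fun ε : ℝ => -(ε • (z - y)) := by fun_prop
    simpa using this.tendsto 0
  have h2 := (h1.eventually h).filter_mono (nhdsWithin_le_nhds (s := Set.Ioi 0))
  obtain ⟨ε, h3, h4⟩ := (h2.and self_mem_nhdsWithin).exists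
  have h5 := hyB.2 _ (hF.subset (h3 (W.neg_mem (W.smul_mem ε (hW z hz)))))
  simp only [map_add, map_neg, map_smul, map_sub, smul_eq_mul] at h5
  have h6 : (0 : ℝ) < ε := h4
  have h7 : l y ≤ l z := by
    by_contra! h7
    nlinarith [mul_pos h6 (sub_pos.2 h7)]
  exact ⟨hF.subset hz, fun w hw => (hyB.2 w hw).trans h7⟩

/-- A criterion for `y` to lie in the relative interior of a closed convex set. -/
lemma eventually_add_mem {F : Set (Euc d)} (hF : Convex ℝ F) (hc : IsClosed F) (hne : F.Nonempty)
    {y : Euc d} {W : Submodule ℝ (Euc d)} (hW : ∀ z ∈ F, z - y ∈ W)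
    (h : ∀ u ∈ W, u ≠ 0 → ∃ z ∈ F, 0 < inner ℝ u (z - y)) :
    ∀ᶠ w in 𝓝 (0 : Euc d), w ∈ W → y + w ∈ F := by
  have hK : IsCompact (Metric.sphere (0 : Euc d) 1 ∩ W) :=
    (isCompact_sphere 0 1).inter_right W.closed_of_finiteDimensional
  -- Compactness of the unit sphere of `W` makes the admissible size of `w` uniform in the direction
  -- `u`.
  have h1 : ∀ᶠ w in 𝓝 (0 : Euc d), ∀ u ∈ Metric.sphere (0 : Euc d) 1 ∩ W,
      ∃ z ∈ F, 0 < inner ℝ u (z - y - w) := by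
    refine hK.eventually_forall_of_forall_eventually fun u hu => ?_
    obtain ⟨z, hz, h2⟩ := h u hu.2 (ne_zero_of_mem_unit_sphere ⟨u, hu.1⟩)
    have h3 : Continuous fun p : Euc d × Euc d => (inner ℝ p.2 (z - y - p.1) : ℝ) := by fun_prop
    have h4 := (h3.tendsto ((0 : Euc d), u)).eventually_const_lt (u := 0) (by simpa using h2)
    exact h4.mono fun p hp => ⟨z, hz, hp⟩
  filter_upwards [h1] with w hw hwW
  by_contra hn
  obtain ⟨u', hu'⟩ := exists_inner_lt_of_notMem hF hc hn
  -- The separating vector may be projected to `W`, because all differences it is tested on lie in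
  -- `W`.
  have h5 : ∀ z ∈ F, inner ℝ (W.starProjection u') (z - y - w) < 0 := fun z hz => by
    rw [Submodule.inner_starProjection_left_eq_right,
      Submodule.starProjection_eq_self_iff.2 (W.sub_mem (hW z hz) hwW), sub_sub, inner_sub_right]
    linarith [hu' z hz]
  set u := W.starProjection u'
  have hu0 : u ≠ 0 := by
    rintro h0
    obtain ⟨z, hz⟩ := hne
    simpa [h0] using h5 z hz
  have huW : u ∈ W := W.starProjection_apply_mem u'
  obtain ⟨z, hz, h6⟩ := hw (‖u‖⁻¹ • u) ⟨by simp [norm_smul, hu0], W.smul_mem _ huW⟩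
  rw [inner_smul_left] at h6
  have h7 := h5 z hz
  have h8 : 0 < ‖u‖⁻¹ := inv_pos.2 (norm_pos_iff.2 hu0)
  simp only [conj_trivial] at h6
  nlinarith

/-! ### Nearest points -/

lemma proj_spec {K : Set (Euc d)} (hK : IsCompact K) (hne : K.Nonempty) (y : Euc d) :
    proj K y ∈ K ∧ ∀ z ∈ K, dist y (proj K y) ≤ dist y z := by
  have h : ∃ w, w ∈ K ∧ ∀ z ∈ K, dist y w ≤ dist y z := by
    obtain ⟨w, hw, h⟩ := hK.exists_infDist_eq_dist hne y
    exact ⟨w, hw, fun z hz => h ▸ Metric.infDist_le_dist_of_mem hz⟩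
  exact Classical.epsilon_spec h

lemma proj_eq_self {K : Set (Euc d)} (hK : IsCompact K) {y : Euc d} (hy : y ∈ K) :
    proj K y = y := by
  have h := (proj_spec hK ⟨y, hy⟩ y).2 y hy
  rw [dist_self] at h
  exact (dist_le_zero.1 h).symm

/-! ### Polytopes -/

lemma IsPolytope.isCompact {P : Set (Euc d)} (hP : IsPolytope P) : IsCompact P := by
  obtain ⟨S, hS, -, rfl⟩ := hP
  exact hS.isCompact_convexHull ℝ

lemma IsPolytope.nonempty {P : Set (Euc d)} (hP : IsPolytope P) : P.Nonempty := by
  obtain ⟨S, -, hS, rfl⟩ := hP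
  exact hS.convexHull

lemma IsPolytope.convex {P : Set (Euc d)} (hP : IsPolytope P) : Convex ℝ P := by
  obtain ⟨S, -, -, rfl⟩ := hP
  exact convex_convexHull ℝ S

lemma IsPolytope.finite_vert {P : Set (Euc d)} (hP : IsPolytope P) : (vert P).Finite := by
  obtain ⟨S, hS, -, rfl⟩ := hP
  exact hS.subset extremePoints_convexHull_subset

/-- Krein–Milman, where the closure is superfluous because a finite set has a closed hull. -/
lemma IsPolytope.convexHull_vert {P : Set (Euc d)} (hP : IsPolytope P) :
    convexHull ℝ (vert P) = P := by
  have h : closure (convexHull ℝ (vert P)) = P :=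
    closure_convexHull_extremePoints hP.isCompact hP.convex
  rwa [(hP.finite_vert.isClosed_convexHull ℝ).closure_eq] at h

/-- The face of a polytope that is exposed by a vector in the relative interior of the normal cone
at `y` contains `y` in its relative interior. -/
lemma eventually_add_mem_face {S : Set (Euc d)} (hS : S.Finite) {v y : Euc d}
    (hy : y ∈ convexHull ℝ S) (hv : v ∈ intrinsicInterior ℝ (normalCone (convexHull ℝ S) y)) :
    ∀ᶠ w in 𝓝 (0 : Euc d),
      w ∈ Submodule.span ℝ ((· - y) '' {z ∈ convexHull ℝ S | inner ℝ v (z - y) = 0}) →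
        y + w ∈ {z ∈ convexHull ℝ S | inner ℝ v (z - y) = 0} := by
  set F := {z ∈ convexHull ℝ S | inner ℝ v (z - y) = 0} with hFdef
  have hvN : v ∈ normalCone (convexHull ℝ S) y := intrinsicInterior_subset hv
  have hyF : y ∈ F := ⟨hy, by simp⟩
  have hF := isExposed_setOf_inner_eq_zero hy hvN
  have hFc : IsClosed F := by
    refine (hS.isClosed_convexHull ℝ).inter (isClosed_eq ?_ continuous_const)
    fun_prop
  refine eventually_add_mem (hF.convex (convex_convexHull ℝ S)) hFc ⟨y, hyF⟩
    (fun z hz => Submodule.subset_span ⟨z, hz, rfl⟩) fun u hu hu0 => ?_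
  by_contra! hle
  apply hu0
  -- Off `F` the inequalities for `v` are strict and survive a small change; on `F` the sign of `u`
  -- decides. Finiteness of `S` gives a common `ε`.
  have hN : ∃ ε : ℝ, 0 < ε ∧ v + ε • u ∈ normalCone (convexHull ℝ S) y := by
    have h1 : ∀ᶠ ε in 𝓝[>] (0 : ℝ), ∀ z ∈ S, inner ℝ (v + ε • u) (z - y) ≤ 0 := by
      rw [hS.eventually_all]
      intro z hz
      have hzS := subset_convexHull ℝ S hz
      rcases (hvN z hzS).lt_or_eq with h2 | h2
      · have h3 : Continuous fun ε : ℝ => (inner ℝ (v + ε • u) (z - y) : ℝ) := by fun_prop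
        have h4 := (h3.tendsto 0).eventually_lt_const (u := 0) (by simpa using h2)
        exact (h4.filter_mono nhdsWithin_le_nhds).mono fun ε hε => hε.le
      · filter_upwards [self_mem_nhdsWithin] with ε hε
        have hε' : (0 : ℝ) < ε := hε
        rw [inner_add_left, h2, inner_smul_left, zero_add]
        exact mul_nonpos_of_nonneg_of_nonpos hε'.le (hle z ⟨hzS, h2⟩)
    obtain ⟨ε, h5, h6⟩ := (h1.and self_mem_nhdsWithin).exists
    refine ⟨ε, h6, ?_⟩
    have h7 : convexHull ℝ S ⊆ {z | inner ℝ (v + ε • u) z ≤ inner ℝ (v + ε • u) y} := by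
      refine convexHull_min (fun z hz => ?_) (convex_halfSpace_le (innerₛₗ ℝ (v + ε • u)).isLinear _)
      have := h5 z hz
      rwa [inner_sub_right, sub_nonpos] at this
    intro z hz
    rw [inner_sub_right, sub_nonpos]
    exact h7 hz
  obtain ⟨ε, hε, hN⟩ := hN
  -- Prolonging the segment from `v + ε • u` beyond `v` puts `v - (δ * ε) • u` into the cone. So `u`
  -- is also nonnegative on `F`, hence orthogonal to its span.
  obtain ⟨δ, hδ, hN'⟩ := exists_add_smul_mem_of_mem_intrinsicInterior hv hN
  have h8 : ∀ z ∈ F, inner ℝ u (z - y) = 0 := fun z hz => by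
    refine le_antisymm (hle z hz) ?_
    have h9 := hN' z hz.1
    rw [sub_add_cancel_left, inner_add_left, hz.2, smul_neg, inner_neg_left, inner_smul_left,
      inner_smul_left, zero_add, conj_trivial, conj_trivial, neg_nonpos, ← mul_assoc] at h9
    exact nonneg_of_mul_nonneg_right h9 (mul_pos hδ hε)
  have h10 : ∀ w ∈ Submodule.span ℝ ((· - y) '' F), inner ℝ u w = 0 := fun w hw => by
    induction hw using Submodule.span_induction with
    | mem w hw =>
      obtain ⟨z, hz, rfl⟩ := hw
      exact h8 z hz
    | zero => simp
    | add a b _ _ ha hb => rw [inner_add_right, ha, hb, add_zero]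
    | smul c a _ ha => rw [inner_smul_right, ha, mul_zero]
  exact inner_self_eq_zero.1 (h10 u hu)

/-- Near a Hausdorff stable point the distance to the polytope is the distance to the affine span
of a face, and it is the norm of the residual of a fixed linearly independent family. -/
lemma HausdorffStable.exists_infDist_eq {P : Set (Euc d)} (hP : IsPolytope P) {q : Euc d}
    (hq : HausdorffStable P q) : ∃ (k : ℕ) (b : Fin k → Euc d) (y : Euc d),
      (Matrix.gram ℝ b).det ≠ 0 ∧ ∀ᶠ q' in 𝓝 q, Metric.infDist q' P = ‖residual b (q' - y)‖ ∧
        distAff q' (projFace P q) = ‖residual b (q' - y)‖ := by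
  have hproj := (proj_spec hP.isCompact hP.nonempty q).1
  rcases hq with hq | hq
  -- With a basis of the whole space the residual is identically zero, as both distances are near an
  -- interior point.
  · let b := Module.finBasis ℝ (Euc d)
    have hdet := Matrix.det_gram_ne_zero_iff_linearIndependent (𝕜 := ℝ).2 b.linearIndependent
    refine ⟨_, b, 0, hdet, ?_⟩
    filter_upwards [mem_interior_iff_mem_nhds.1 hq] with q' hq'
    have h0 : residual b (q' - 0) = 0 :=
      InnerProductSpace.ext_inner_right_basis b fun i => by rw [inner_residual hdet, inner_zero_left]
    rw [h0, norm_zero]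
    refine ⟨Metric.infDist_zero_of_mem hq', Metric.infDist_zero_of_mem ?_⟩
    rw [projFace, proj_eq_self hP.isCompact (interior_subset hq), minFace_of_mem_interior hq]
    exact subset_affineSpan ℝ P hq'
  · set y := proj P q
    set v := q - y with hv
    obtain ⟨S, hS, hSne, rfl⟩ := hP
    have hvN : v ∈ normalCone (convexHull ℝ S) y := intrinsicInterior_subset hq
    have hF := isExposed_setOf_inner_eq_zero hproj hvN
    have hint := eventually_add_mem_face hS hproj hq
    set F := {z ∈ convexHull ℝ S | inner ℝ v (z - y) = 0} with hFdef
    set W := Submodule.span ℝ ((· - y) '' F)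
    have hW : ∀ z ∈ F, z - y ∈ W := fun z hz => Submodule.subset_span ⟨z, hz, rfl⟩
    have hface : projFace (convexHull ℝ S) q = F := minFace_eq_of_eventually hF hW hint
    let B := Module.finBasis ℝ W
    let b : Fin (Module.finrank ℝ W) → Euc d := fun i => B i
    have hbW : ∀ i, b i ∈ W := fun i => (B i).2
    have hli : LinearIndependent ℝ b := B.linearIndependent.map' W.subtype W.ker_subtype
    have hdet := Matrix.det_gram_ne_zero_iff_linearIndependent (𝕜 := ℝ).2 hli
    have horth : ∀ u : Euc d, (∀ i, inner ℝ u (b i) = 0) → ∀ w ∈ W, inner ℝ u w = 0 := by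
      intro u hu w hw
      have h1 := congrArg Subtype.val (B.sum_repr ⟨w, hw⟩)
      simp only [Submodule.coe_sum, Submodule.coe_smul] at h1
      rw [← h1, inner_sum]
      exact Finset.sum_eq_zero fun i _ => by
        rw [inner_smul_right]
        exact mul_eq_zero_of_right _ (hu i)
    have hvW : ∀ w ∈ W, inner ℝ v w = 0 := fun w hw => by
      induction hw using Submodule.span_induction with
      | mem w hw =>
        obtain ⟨z, hz, rfl⟩ := hw
        exact hz.2
      | zero => simp
      | add a b _ _ ha hb => rw [inner_add_right, ha, hb, add_zero]
      | smul c a _ ha => rw [inner_smul_right, ha, mul_zero]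
    have hv0 : ∀ i, inner ℝ (b i) (q - y) = 0 := fun i => by
      rw [real_inner_comm]
      exact hvW _ (hbW i)
    refine ⟨_, b, y, hdet, ?_⟩
    have hcw : Continuous fun q' : Euc d => q' - y := by fun_prop
    -- The displacement of the foot from `y` tends to zero, since `q - y` is orthogonal to `W`;
    -- hence the foot remains in `F`.
    have hc : Tendsto (fun q' : Euc d => ∑ i, gramCoeff b (q' - y) i • b i) (𝓝 q) (𝓝 0) := by
      have h1 : ContinuousAt (fun q' : Euc d => gramCoeff b (q' - y)) q :=
        continuousAt_gramCoeff continuous_const hcw hdet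
      have h2 : Continuous fun c : Fin (Module.finrank ℝ W) → ℝ => ∑ i, c i • b i := by fun_prop
      have h3 := (h2.continuousAt.comp h1).tendsto
      simpa [Function.comp_def, gramCoeff_eq_zero hv0] using h3
    have hr : Tendsto (fun q' : Euc d => residual b (q' - y)) (𝓝 q) (𝓝 v) := by
      have h1 : ContinuousAt (fun q' : Euc d => residual b (q' - y)) q :=
        continuousAt_residual continuous_const hcw hdet
      have h2 := h1.tendsto
      rwa [residual_eq_self hv0] at h2
    have hneg : ∀ᶠ q' in 𝓝 q, ∀ z ∈ S, z ∉ F →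
        inner ℝ (residual b (q' - y)) (z - (y + ∑ i, gramCoeff b (q' - y) i • b i)) < 0 := by
      rw [hS.eventually_all]
      intro z hz
      by_cases hzF : z ∈ F
      · simp [hzF]
      · have h1 : inner ℝ v (z - (y + 0)) < 0 := by
          rw [add_zero]
          have hzS := subset_convexHull ℝ S hz
          exact lt_of_le_of_ne (hvN z hzS) fun h => hzF ⟨hzS, h⟩
        have h2 := Tendsto.inner (𝕜 := ℝ) hr (tendsto_const_nhds (x := z) |>.sub (hc.const_add y))
        exact (h2.eventually_lt_const h1).mono fun q' h _ => h
    filter_upwards [hc.eventually hint, hneg] with q' h1 h2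
    set w := ∑ i, gramCoeff b (q' - y) i • b i with hw
    have hwW : w ∈ W := W.sum_mem fun i _ => W.smul_mem _ (hbW i)
    have hyF := h1 hwW
    have hres : residual b (q' - y) = q' - (y + w) := by rw [residual, sub_sub]
    have hresW := horth _ (inner_residual hdet (q' - y))
    have hF0 : ∀ z ∈ F, inner ℝ (residual b (q' - y)) (z - (y + w)) = 0 := fun z hz => by
      apply hresW
      rw [← sub_sub]
      exact W.sub_mem (hW z hz) hwW
    constructor
    · rw [hres]
      refine infDist_eq_of_inner_nonpos hyF.1 fun z hz => ?_
      rw [← hres]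
      have h7 : convexHull ℝ S ⊆ {z | inner ℝ (residual b (q' - y)) z ≤
          inner ℝ (residual b (q' - y)) (y + w)} := by
        refine convexHull_min (fun z hz => ?_) (convex_halfSpace_le (innerₛₗ ℝ _).isLinear _)
        rw [Set.mem_ofPred_eq, ← sub_nonpos, ← inner_sub_right]
        by_cases hzF : z ∈ F
        · exact (hF0 z hzF).le
        · exact (h2 z hz hzF).le
      rw [inner_sub_right, sub_nonpos]
      exact h7 hz
    · rw [distAff, hface, hres]
      rw [hres] at hF0
      exact infDist_affineSpan_eq (subset_affineSpan ℝ F hyF) hF0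

/-- A Hausdorff stable point of a full-dimensional polytope has distance zero from the affine span
of its face. -/
lemma HausdorffStable.distAff_eq_zero {P : Set (Euc d)} (hP : IsPolytope P) {q : Euc d}
    (hq : HausdorffStable P q) (hqP : q ∈ P) (hint : (interior P).Nonempty) (q' : Euc d) :
    distAff q' (projFace P q) = 0 := by
  have hproj : proj P q = q := proj_eq_self hP.isCompact hqP
  have hface : projFace P q = P := by
    rw [projFace, hproj]
    rcases hq with hq | hq
    · exact minFace_of_mem_interior hq
    -- Here zero is in the relative interior of the normal cone, and the face exposed by the zero
    -- vector is the whole polytope.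
    · rw [hproj, sub_self] at hq
      obtain ⟨S, hS, hSne, rfl⟩ := hP
      have hF := isExposed_setOf_inner_eq_zero hqP (intrinsicInterior_subset hq)
      have hint := eventually_add_mem_face hS hqP hq
      have hW : ∀ z ∈ {z ∈ convexHull ℝ S | inner ℝ 0 (z - q) = (0 : ℝ)}, z - q ∈
          Submodule.span ℝ ((· - q) '' {z ∈ convexHull ℝ S | inner ℝ 0 (z - q) = (0 : ℝ)}) :=
        fun z hz => Submodule.subset_span ⟨z, hz, rfl⟩
      rw [minFace_eq_of_eventually hF hW hint]
      simp
  rw [distAff, hface]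
  apply Metric.infDist_zero_of_mem
  rw [(hP.convex.interior_nonempty_iff_affineSpan_eq_top).1 hint]
  exact AffineSubspace.mem_top ℝ _ q'

/-! ### The support function of a zonotope -/

/-- The support function of the zonotope with parameters `x`. -/
noncomputable def support (x : Param n d) (u : Euc d) : ℝ :=
  ∑ i, max 0 (inner ℝ u (x.1 i)) + inner ℝ u x.2

/-- `u` attains its maximum over the zonotope at the image of the point `t` of the cube. -/
def Compat (x : Param n d) (u : Euc d) (t : Fin n → ℝ) : Prop :=
  ∀ i, (0 < inner ℝ u (x.1 i) → t i = 1) ∧ (inner ℝ u (x.1 i) < 0 → t i = 0)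

/-- `u` attains its maximum over the zonotope exactly at the images of the smallest face of the
cube that contains `t`. -/
def StrictCompat (x : Param n d) (u : Euc d) (t : Fin n → ℝ) : Prop :=
  ∀ i, (t i = 1 → 0 < inner ℝ u (x.1 i)) ∧ (t i = 0 → inner ℝ u (x.1 i) < 0) ∧
    (t i ≠ 0 → t i ≠ 1 → inner ℝ u (x.1 i) = 0)

/-- The smallest face of the cube that contains `t`. -/
def cubeFace (t : Fin n → ℝ) : Set (Fin n → ℝ) :=
  {s | s ∈ cube n ∧ ∀ i, t i = 0 ∨ t i = 1 → s i = t i}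

lemma mem_cubeFace_self {t : Fin n → ℝ} (ht : t ∈ cube n) : t ∈ cubeFace t := ⟨ht, fun _ _ => rfl⟩

lemma inner_affMap (x : Param n d) (u : Euc d) (t : Fin n → ℝ) :
    inner ℝ u (affMap x t) = ∑ i, t i * inner ℝ u (x.1 i) + inner ℝ u x.2 := by
  simp [affMap, inner_add_right, inner_sum, inner_smul_right]

lemma mul_le_max {a b : ℝ} (h0 : 0 ≤ a) (h1 : a ≤ 1) : a * b ≤ max 0 b := by
  rcases le_total 0 b with h | h
  · rw [max_eq_right h]
    exact mul_le_of_le_one_left h h1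
  · rw [max_eq_left h]
    exact mul_nonpos_of_nonneg_of_nonpos h0 h

lemma inner_affMap_le_support {x : Param n d} {t : Fin n → ℝ} (ht : t ∈ cube n) (u : Euc d) :
    inner ℝ u (affMap x t) ≤ support x u := by
  rw [inner_affMap, support]
  gcongr with i
  exact mul_le_max (ht.1 i) (ht.2 i)

lemma inner_le_support {x : Param n d} {z : Euc d} (hz : z ∈ zonotope x) (u : Euc d) :
    inner ℝ u z ≤ support x u := by
  obtain ⟨t, ht, rfl⟩ := hz
  exact inner_affMap_le_support ht u

/-- The bound by the support function holds summand by summand, so equality of the sums forces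
equality in each coordinate. -/
lemma support_le_inner_affMap_iff {x : Param n d} {u : Euc d} {t : Fin n → ℝ} (ht : t ∈ cube n) :
    support x u ≤ inner ℝ u (affMap x t) ↔ Compat x u t := by
  have hle : ∀ i ∈ Finset.univ, t i * inner ℝ u (x.1 i) ≤ max 0 (inner ℝ u (x.1 i)) :=
    fun i _ => mul_le_max (ht.1 i) (ht.2 i)
  have h1 : support x u ≤ inner ℝ u (affMap x t) ↔
      ∑ i, t i * inner ℝ u (x.1 i) = ∑ i, max 0 (inner ℝ u (x.1 i)) := by
    rw [inner_affMap, support, add_le_add_iff_right]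
    exact ⟨fun h => le_antisymm (Finset.sum_le_sum hle) h, fun h => h.ge⟩
  rw [h1, Finset.sum_eq_sum_iff_of_le hle]
  simp only [Finset.mem_univ, forall_const]
  refine forall_congr' fun i => ?_
  rcases lt_trichotomy (inner ℝ u (x.1 i)) 0 with h | h | h
  · simp [max_eq_left h.le, h, h.ne, h.not_gt]
  · simp [h]
  · simp [max_eq_right h.le, h, h.ne', h.not_gt]

lemma Compat.inner_eq {x : Param n d} {u : Euc d} {t : Fin n → ℝ} (h : Compat x u t)
    (ht : t ∈ cube n) : inner ℝ u (affMap x t) = support x u :=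
  le_antisymm (inner_affMap_le_support ht u) ((support_le_inner_affMap_iff ht).2 h)

lemma StrictCompat.compat_iff {x : Param n d} {u : Euc d} {t s : Fin n → ℝ}
    (h : StrictCompat x u t) (hs : s ∈ cube n) : Compat x u s ↔ s ∈ cubeFace t := by
  constructor
  · refine fun hc => ⟨hs, fun i hi => ?_⟩
    rcases hi with hi | hi
    · rw [hi, (hc i).2 ((h i).2.1 hi)]
    · rw [hi, (hc i).1 ((h i).1 hi)]
  · rintro ⟨-, hst⟩ i
    by_cases h0 : t i = 0
    · have := (h i).2.1 h0
      exact ⟨fun h' => absurd h' this.not_gt, fun _ => by rw [hst i (Or.inl h0), h0]⟩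
    · by_cases h1 : t i = 1
      · have := (h i).1 h1
        exact ⟨fun _ => by rw [hst i (Or.inr h1), h1], fun h' => absurd h' this.not_gt⟩
      · have := (h i).2.2 h0 h1
        simp [this]

lemma Compat.of_mem_cubeFace {x : Param n d} {u : Euc d} {t s : Fin n → ℝ} (h : Compat x u t)
    (hs : s ∈ cubeFace t) : Compat x u s := fun i =>
  ⟨fun hi => by rw [hs.2 i (Or.inr ((h i).1 hi)), (h i).1 hi],
    fun hi => by rw [hs.2 i (Or.inl ((h i).2 hi)), (h i).2 hi]⟩

/-- Every vector attains its maximum over the zonotope at the image of a vertex of the cube. -/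
lemma exists_compat (x : Param n d) (u : Euc d) :
    ∃ t ∈ cube n, Compat x u t ∧ ∀ i, t i = 0 ∨ t i = 1 := by
  classical
  -- Generators orthogonal to `u` could get any coefficient; the value 0 keeps `t` a vertex of the
  -- cube.
  let t : Fin n → ℝ := fun i => if 0 < inner ℝ u (x.1 i) then 1 else 0
  have h01 : ∀ i, t i = 0 ∨ t i = 1 := fun i => by
    simp only [t]
    split_ifs <;> simp
  refine ⟨t, ⟨fun i => ?_, fun i => ?_⟩, fun i => ⟨fun hi => by simp [t, hi],
    fun hi => by simp [t, hi.not_gt]⟩, h01⟩ <;> rcases h01 i with h | h <;> simp [h]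

/-- This dictionary turns normal cones into sign conditions on the generators. -/
lemma mem_normalCone_zonotope_iff {x : Param n d} {u : Euc d} {t : Fin n → ℝ} (ht : t ∈ cube n) :
    u ∈ normalCone (zonotope x) (affMap x t) ↔ Compat x u t := by
  have hmem : ∀ z, inner ℝ u (z - affMap x t) ≤ 0 ↔ inner ℝ u z ≤ inner ℝ u (affMap x t) :=
    fun z => by rw [inner_sub_right, sub_nonpos]
  constructor
  · intro h
    obtain ⟨s, hs, hsc, -⟩ := exists_compat x u
    rw [← support_le_inner_affMap_iff ht, ← hsc.inner_eq hs, ← hmem]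
    exact h _ ⟨s, hs, rfl⟩
  · intro h z hz
    rw [hmem, h.inner_eq ht]
    exact inner_le_support hz u

lemma continuous_support : Continuous fun p : Param n d × Euc d => support p.1 p.2 := by
  unfold support
  fun_prop

lemma continuous_affMap_param (t : Fin n → ℝ) : Continuous fun x : Param n d => affMap x t := by
  unfold affMap
  fun_prop

/-- The affine map `t ↦ Q t + μ`, bundled. -/
noncomputable def affMapAffine (x : Param n d) : (Fin n → ℝ) →ᵃ[ℝ] Euc d :=
  (Fintype.linearCombination ℝ x.1).toAffineMap + AffineMap.const ℝ (Fin n → ℝ) x.2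

lemma coe_affMapAffine (x : Param n d) : ⇑(affMapAffine x) = affMap x := by
  ext1 t
  simp [affMapAffine, affMap, Fintype.linearCombination_apply]

/-- The cube is the hull of its 0/1 points, and affine maps commute with convex hulls. -/
lemma isPolytope_zonotope (x : Param n d) : IsPolytope (zonotope x) := by
  refine ⟨affMap x '' Set.univ.pi fun _ => {0, 1}, ?_, ?_, ?_⟩
  · exact (Set.Finite.pi fun _ => Set.toFinite _).image _
  · exact Set.Nonempty.image _ ⟨0, fun i _ => by simp⟩
  · rw [← coe_affMapAffine, ← AffineMap.image_convexHull, convexHull_pi, zonotope,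
      ← coe_affMapAffine]
    congr 1
    ext t
    simp only [convexHull_pair, segment_eq_Icc zero_le_one, cube, Set.mem_pi, Set.mem_univ,
      forall_const, Set.mem_Icc, Pi.le_def, Pi.zero_apply, Pi.one_apply]
    exact ⟨fun h i => ⟨h.1 i, h.2 i⟩, fun h => ⟨fun i => (h i).1, fun i => (h i).2⟩⟩

lemma exists_unit_inner_gt {K : Set (Euc d)} (hK : Convex ℝ K) (hc : IsClosed K)
    (hne : K.Nonempty) {p : Euc d} (hp : p ∉ K) :
    ∃ u ∈ Metric.sphere (0 : Euc d) 1, ∀ z ∈ K, inner ℝ u z < inner ℝ u p := by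
  obtain ⟨u, hu⟩ := exists_inner_lt_of_notMem hK hc hp
  have hu0 : u ≠ 0 := by
    rintro rfl
    obtain ⟨z, hz⟩ := hne
    simpa using hu z hz
  refine ⟨‖u‖⁻¹ • u, by simp [norm_smul, hu0], fun z hz => ?_⟩
  rw [inner_smul_left, inner_smul_left]
  exact mul_lt_mul_of_pos_left (hu z hz) (by simpa using hu0)

/-- By separation. Testing unit vectors only makes compactness available for perturbations. -/
lemma mem_zonotope_of_le_support {x : Param n d} {p : Euc d}
    (h : ∀ u ∈ Metric.sphere (0 : Euc d) 1, inner ℝ u p ≤ support x u) : p ∈ zonotope x := by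
  by_contra hp
  have hZ := isPolytope_zonotope x
  obtain ⟨u, hu, h1⟩ := exists_unit_inner_gt hZ.convex hZ.isCompact.isClosed hZ.nonempty hp
  obtain ⟨s, hs, hsc, -⟩ := exists_compat x u
  have h2 := h1 _ ⟨s, hs, rfl⟩
  rw [hsc.inner_eq hs] at h2
  exact (h u hu).not_gt h2

/-- A strict inequality with the support function is preserved under perturbations. -/
lemma eventually_mem_zonotope {x : Param n d} {p : Euc d}
    (h : ∀ u ∈ Metric.sphere (0 : Euc d) 1, inner ℝ u p < support x u) :
    ∀ᶠ q in 𝓝 (x, p), q.2 ∈ zonotope q.1 := by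
  have h1 : ∀ᶠ q in 𝓝 (x, p), ∀ u ∈ Metric.sphere (0 : Euc d) 1,
      inner ℝ u q.2 < support q.1 u := by
    refine (isCompact_sphere 0 1).eventually_forall_of_forall_eventually fun u hu => ?_
    have h2 : Continuous fun r : (Param n d × Euc d) × Euc d => (inner ℝ r.2 r.1.2 : ℝ) := by
      fun_prop
    have h3 : Continuous fun r : (Param n d × Euc d) × Euc d => support r.1.1 r.2 :=
      continuous_support.comp (f := fun r : (Param n d × Euc d) × Euc d => (r.1.1, r.2))
        (by fun_prop)
    exact (h2.tendsto ((x, p), u)).eventually_lt (h3.tendsto ((x, p), u)) (h u hu)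
  exact h1.mono fun q hq => mem_zonotope_of_le_support fun u hu => (hq u hu).le

/-- If all inequalities were strict, they would persist for nearby points. No full-dimensionality is
assumed, so this also yields normals of flat zonotopes. -/
lemma exists_support_le_inner_of_notMem_interior {x : Param n d} {p : Euc d}
    (hp : p ∉ interior (zonotope x)) : ∃ u, u ≠ 0 ∧ support x u ≤ inner ℝ u p := by
  by_contra! h
  apply hp
  rw [mem_interior_iff_mem_nhds]
  have h1 := eventually_mem_zonotope (x := x) (p := p) fun u hu =>
    h u (ne_zero_of_mem_unit_sphere ⟨u, hu⟩)
  have h2 : Continuous fun p' : Euc d => (x, p') := by fun_prop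
  exact (h2.tendsto p).eventually h1

lemma eventually_mem_zonotope_of_mem_interior {x : Param n d} {p : Euc d}
    (hp : p ∈ interior (zonotope x)) : ∀ᶠ x' in 𝓝 x, p ∈ zonotope x' := by
  have h1 : ∀ᶠ q in 𝓝 (x, p), q.2 ∈ zonotope q.1 := eventually_mem_zonotope fun u hu => by
    by_contra! hle
    exact ne_zero_of_mem_unit_sphere ⟨u, hu⟩ (eq_zero_of_isMax_of_mem_interior hp
      fun z hz => (inner_le_support hz u).trans hle)
  have h2 : Continuous fun x' : Param n d => (x', p) := by fun_prop
  exact (h2.tendsto x).eventually h1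

/-! ### The boundary of a zonotope -/

/-- Together with `Compat.mem_frontier` this describes the boundary by cube points that have a
nonzero compatible vector. -/
lemma exists_compat_of_mem_frontier {x : Param n d} {q : Euc d} (hq : q ∈ frontier (zonotope x)) :
    ∃ t ∈ cube n, affMap x t = q ∧ ∃ u, u ≠ 0 ∧ Compat x u t := by
  rw [(isPolytope_zonotope x).isCompact.isClosed.frontier_eq] at hq
  obtain ⟨⟨t, ht, rfl⟩, hq⟩ := hq
  obtain ⟨u, hu, hle⟩ := exists_support_le_inner_of_notMem_interior hq
  exact ⟨t, ht, rfl, u, hu, (support_le_inner_affMap_iff ht).1 hle⟩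

lemma Compat.mem_frontier {x : Param n d} {u : Euc d} {t : Fin n → ℝ} (h : Compat x u t)
    (ht : t ∈ cube n) (hu : u ≠ 0) : affMap x t ∈ frontier (zonotope x) := by
  rw [(isPolytope_zonotope x).isCompact.isClosed.frontier_eq]
  refine ⟨⟨t, ht, rfl⟩, fun hint => hu (eq_zero_of_isMax_of_mem_interior hint fun z hz => ?_)⟩
  rw [h.inner_eq ht]
  exact inner_le_support hz u

/-! ### General position -/

/-- More than `d` such generators would include `d` independent ones, which span the space and would
make `u` orthogonal to itself. With at most `d` of them general position applies. -/
lemma GeneralPosition.linearIndependent {x : Param n d} (hx : GeneralPosition x) {u : Euc d}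
    (hu : u ≠ 0) {p : Fin n → Prop} (hp : ∀ i, p i → inner ℝ u (x.1 i) = 0) :
    LinearIndependent ℝ fun i : {i // p i} => x.1 i := by
  classical
  set s : Finset (Fin n) := {i | p i} with hs
  have hcard : s.card ≤ d := by
    by_contra! hlt
    obtain ⟨r, hrs, hr⟩ := Finset.exists_subset_card_eq hlt.le
    have hli := hx r hr.le
    have hspan : Submodule.span ℝ (Set.range fun i : r => x.1 i) = ⊤ :=
      hli.span_eq_top_of_card_eq_finrank' (by simp [hr])
    have hle : Submodule.span ℝ (Set.range fun i : r => x.1 i) ≤ (Submodule.span ℝ {u})ᗮ := by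
      rw [Submodule.span_le]
      rintro _ ⟨i, rfl⟩
      rw [SetLike.mem_coe, Submodule.mem_orthogonal_singleton_iff_inner_right]
      exact hp _ (by simpa [hs] using hrs i.2)
    rw [hspan, top_le_iff] at hle
    have hmem : u ∈ (Submodule.span ℝ {u})ᗮ := hle ▸ Submodule.mem_top
    rw [Submodule.mem_orthogonal_singleton_iff_inner_right] at hmem
    exact hu (inner_self_eq_zero.1 hmem)
  have hli := hx s hcard
  exact hli.comp (fun i : {i // p i} => (⟨i.1, by simp [hs, i.2]⟩ : s)) fun i j hij => by
    simpa [Subtype.ext_iff] using hij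

lemma sum_subtype_eq_sum {ι M : Type*} [Fintype ι] [AddCommMonoid M] {p : ι → Prop}
    [DecidablePred p] {f : ι → M} (h : ∀ i, ¬p i → f i = 0) :
    ∑ i : {i // p i}, f i = ∑ i, f i := by
  rw [← Finset.sum_subtype (Finset.univ.filter p) (by simp) f]
  exact Finset.sum_filter_of_ne fun i _ hi => by_contra fun hp => hi (h i hp)

/-- Points of the cube at which a nonzero vector attains its maximum are determined by their
images. -/
lemma GeneralPosition.lift_eq_singleton {x : Param n d} (hx : GeneralPosition x) {u : Euc d}
    (hu : u ≠ 0) {t : Fin n → ℝ} (ht : t ∈ cube n) (h : Compat x u t) :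
    lift x (affMap x t) = {t} := by
  classical
  refine Set.eq_singleton_iff_unique_mem.2 ⟨⟨ht, rfl⟩, fun s hs => ?_⟩
  obtain ⟨hsc, hst⟩ := hs
  have hs' : Compat x u s := by
    rw [← support_le_inner_affMap_iff hsc, hst, h.inner_eq ht]
  have hli := hx.linearIndependent hu (p := fun i => inner ℝ u (x.1 i) = 0) fun _ hi => hi
  -- Two lifts can differ only on generators orthogonal to `u`, and these are independent.
  have hoff : ∀ i, inner ℝ u (x.1 i) ≠ 0 → s i = t i := fun i hi => by
    rcases hi.lt_or_gt with hi | hi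
    · rw [(hs' i).2 hi, (h i).2 hi]
    · rw [(hs' i).1 hi, (h i).1 hi]
  have hsum : ∑ i : {i // inner ℝ u (x.1 i) = 0}, (s i - t i) • x.1 i = 0 := by
    have h1 : ∑ i, (s i - t i) • x.1 i = 0 := by
      simp only [affMap, add_left_inj] at hst
      simp [sub_smul, hst]
    rw [← h1]
    refine sum_subtype_eq_sum (f := fun i => (s i - t i) • x.1 i) fun i hi => ?_
    rw [hoff i hi, sub_self, zero_smul]
  have hzero := Fintype.linearIndependent_iff.1 hli _ hsum
  ext i
  by_cases hi : inner ℝ u (x.1 i) = 0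
  · exact sub_eq_zero.1 (hzero ⟨i, hi⟩)
  · exact hoff i hi

lemma GeneralPosition.stablePoint {x : Param n d} (hx : GeneralPosition x) {q : Euc d}
    (hq : q ∈ frontier (zonotope x)) : StablePoint x q := by
  obtain ⟨t, ht, rfl, u, hu, hc⟩ := exists_compat_of_mem_frontier hq
  exact ⟨t, hx.lift_eq_singleton hu ht hc⟩

/-- A nonzero vector with its maximum at the image of `t` may be perturbed to a vector with its
maximum exactly at the images of the smallest face of the cube that contains `t`. -/
lemma GeneralPosition.exists_strictCompat {x : Param n d} (hx : GeneralPosition x) {u : Euc d}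
    (hu : u ≠ 0) {t : Fin n → ℝ} (h : Compat x u t) : ∃ u', StrictCompat x u' t := by
  classical
  have hli := hx.linearIndependent hu (p := fun i => inner ℝ u (x.1 i) = 0) fun _ hi => hi
  -- On the generators orthogonal to `u` the sign required by `t` is prescribed; the others keep
  -- their sign for small `ε`.
  obtain ⟨w, hw⟩ := exists_inner_eq hli fun i => if t i = 1 then 1 else if t i = 0 then -1 else 0
  have hc : ∀ i, Tendsto (fun ε : ℝ => (inner ℝ (u + ε • w) (x.1 i) : ℝ)) (𝓝 0)
      (𝓝 (inner ℝ u (x.1 i))) := fun i => by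
    have : Continuous fun ε : ℝ => (inner ℝ (u + ε • w) (x.1 i) : ℝ) := by fun_prop
    simpa using this.tendsto 0
  have h1 : ∀ᶠ ε in 𝓝[>] (0 : ℝ), ∀ i, (t i = 1 → 0 < inner ℝ (u + ε • w) (x.1 i)) ∧
      (t i = 0 → inner ℝ (u + ε • w) (x.1 i) < 0) ∧
      (t i ≠ 0 → t i ≠ 1 → inner ℝ (u + ε • w) (x.1 i) = 0) := by
    rw [eventually_all]
    intro i
    rcases lt_trichotomy (inner ℝ u (x.1 i)) 0 with hi | hi | hi
    · have ht := (h i).2 hi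
      filter_upwards [((hc i).eventually_lt_const hi).filter_mono nhdsWithin_le_nhds] with ε hε
      simp [ht, hε]
    · filter_upwards [self_mem_nhdsWithin] with ε hε
      have hε' : (0 : ℝ) < ε := hε
      have hwi := hw ⟨i, hi⟩
      simp only at hwi
      rw [inner_add_left, hi, inner_smul_left, hwi, zero_add, conj_trivial]
      refine ⟨fun ht => ?_, fun ht => ?_, fun h0 h1 => ?_⟩
      · simp [ht, hε']
      · simp [ht, hε']
      · simp [h0, h1]
    · have ht := (h i).1 hi
      filter_upwards [((hc i).eventually_const_lt hi).filter_mono nhdsWithin_le_nhds] with ε hε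
      simp [ht, hε]
  obtain ⟨ε, hε⟩ := h1.exists
  exact ⟨u + ε • w, hε⟩

/-- The signs of the inner products of a nonzero vector with the generators are realized by
another nonzero vector after a perturbation of the generators. -/
lemma GeneralPosition.eventually_exists_sign_eq {x₀ : Param n d} (hx : GeneralPosition x₀)
    {u : Euc d} (hu : u ≠ 0) : ∀ᶠ x in 𝓝 x₀, ∃ u', u' ≠ 0 ∧ ∀ i,
      SignType.sign (inner ℝ u' (x.1 i) : ℝ) = SignType.sign (inner ℝ u (x₀.1 i) : ℝ) := by
  classical
  have hli := hx.linearIndependent hu (p := fun i => inner ℝ u (x₀.1 i) = 0) fun _ hi => hi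
  let b : Param n d → {i // inner ℝ u (x₀.1 i) = 0} → Euc d := fun x i => x.1 i
  have hb : Continuous b := by fun_prop
  have hdet : (Matrix.gram ℝ (b x₀)).det ≠ 0 :=
    Matrix.det_gram_ne_zero_iff_linearIndependent.2 hli
  -- The residual makes vanishing products vanish exactly after perturbation, and it is close enough
  -- to `u` to keep the strict signs.
  have hr : Tendsto (fun x => residual (b x) u) (𝓝 x₀) (𝓝 u) := by
    have h1 := (continuousAt_residual hb (continuous_const (y := u)) hdet).tendsto
    rwa [residual_eq_self fun i => by rw [real_inner_comm]; exact i.2] at h1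
  have hs : ∀ᶠ x in 𝓝 x₀, ∀ i,
      SignType.sign (inner ℝ (residual (b x) u) (x.1 i) : ℝ) =
        SignType.sign (inner ℝ u (x₀.1 i) : ℝ) := by
    rw [eventually_all]
    intro i
    have hxi : Tendsto (fun x : Param n d => x.1 i) (𝓝 x₀) (𝓝 (x₀.1 i)) := by
      have : Continuous fun x : Param n d => x.1 i := by fun_prop
      exact this.tendsto x₀
    have hi' := Tendsto.inner (𝕜 := ℝ) hr hxi
    rcases lt_trichotomy (inner ℝ u (x₀.1 i)) 0 with hi | hi | hi
    · filter_upwards [hi'.eventually_lt_const hi] with x hx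
      rw [sign_neg hi, sign_neg hx]
    · filter_upwards [eventually_det_gram_ne_zero hb hdet] with x hx
      rw [hi, show inner ℝ (residual (b x) u) (x.1 i) = (0 : ℝ) from inner_residual hx u ⟨i, hi⟩]
    · filter_upwards [hi'.eventually_const_lt hi] with x hx
      rw [sign_pos hi, sign_pos hx]
  filter_upwards [hs, hr.eventually_ne hu] with x h1 h2
  exact ⟨_, h2, h1⟩

lemma Compat.congr_sign {x x' : Param n d} {u u' : Euc d} {t : Fin n → ℝ} (h : Compat x u t)
    (hs : ∀ i, SignType.sign (inner ℝ u' (x'.1 i) : ℝ) = SignType.sign (inner ℝ u (x.1 i) : ℝ)) :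
    Compat x' u' t := fun i => by
  constructor <;> intro hi
  · apply (h i).1
    rwa [← sign_eq_one_iff, ← hs, sign_eq_one_iff]
  · apply (h i).2
    rwa [← sign_eq_neg_one_iff, ← hs, sign_eq_neg_one_iff]

lemma pushforward_affMap {x₀ x : Param n d} {t : Fin n → ℝ} (h : lift x₀ (affMap x₀ t) = {t}) :
    pushforward x₀ x (affMap x₀ t) = affMap x t := by
  rw [pushforward, h]
  congr 1
  exact Classical.epsilon_spec (p := fun s => s ∈ ({t} : Set (Fin n → ℝ))) ⟨t, rfl⟩

/-- For nearby zonotopes the pushforward maps the boundary to the boundary. -/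
lemma GeneralPosition.eventually_mapsTo_frontier {x₀ : Param n d} (hx : GeneralPosition x₀) :
    ∀ᶠ x in 𝓝 x₀,
      Set.MapsTo (pushforward x₀ x) (frontier (zonotope x₀)) (frontier (zonotope x)) := by
  -- There are finitely many sign vectors, so one neighborhood serves all boundary points.
  have h1 : ∀ᶠ x in 𝓝 x₀, ∀ σ : Fin n → SignType,
      (∃ u : Euc d, u ≠ 0 ∧ ∀ i, SignType.sign (inner ℝ u (x₀.1 i) : ℝ) = σ i) →
        ∃ u : Euc d, u ≠ 0 ∧ ∀ i, SignType.sign (inner ℝ u (x.1 i) : ℝ) = σ i := by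
    rw [eventually_all]
    intro σ
    by_cases hσ : ∃ u : Euc d, u ≠ 0 ∧ ∀ i, SignType.sign (inner ℝ u (x₀.1 i) : ℝ) = σ i
    · obtain ⟨u, hu, hσ⟩ := hσ
      filter_upwards [hx.eventually_exists_sign_eq hu] with x hx _
      simpa only [hσ] using hx
    · simp [hσ]
  filter_upwards [h1] with x h1 q hq
  obtain ⟨t, ht, rfl, u, hu, hc⟩ := exists_compat_of_mem_frontier hq
  rw [pushforward_affMap (hx.lift_eq_singleton hu ht hc)]
  obtain ⟨u', hu', hs⟩ := h1 _ ⟨u, hu, fun _ => rfl⟩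
  exact (hc.congr_sign hs).mem_frontier ht hu'

/-! ### Vertices -/

/-- The cube face of a 0/1 point is that point alone, so `u` exposes its image. -/
lemma StrictCompat.affMap_mem_vert {x : Param n d} {u : Euc d} {t : Fin n → ℝ}
    (h : StrictCompat x u t) (ht : t ∈ cube n) (h01 : ∀ i, t i = 0 ∨ t i = 1) :
    affMap x t ∈ vert (zonotope x) := by
  apply exposedPoints_subset_extremePoints
  refine ⟨⟨t, ht, rfl⟩, innerSL ℝ u, ?_⟩
  have htc := (h.compat_iff ht).2 (mem_cubeFace_self ht)
  rintro _ ⟨s, hs, rfl⟩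
  simp only [innerSL_apply_apply]
  rw [htc.inner_eq ht]
  refine ⟨inner_affMap_le_support hs u, fun hle => ?_⟩
  have h1 := (h.compat_iff hs).1 ((support_le_inner_affMap_iff hs).1 hle)
  congr 1
  exact funext fun i => h1.2 i (h01 i)

/-- The pushforwards of the vertices span nearby zonotopes. -/
lemma GeneralPosition.eventually_zonotope_subset {x₀ : Param n d} (hx : GeneralPosition x₀) :
    ∀ᶠ x in 𝓝 x₀, zonotope x ⊆ convexHull ℝ (pushforward x₀ x '' vert (zonotope x₀)) := by
  have hZ := isPolytope_zonotope x₀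
  have h1 : ∀ᶠ x in 𝓝 x₀, ∀ u ∈ Metric.sphere (0 : Euc d) 1, ∃ q ∈ vert (zonotope x₀),
      support x u ≤ inner ℝ u (pushforward x₀ x q) := by
    refine (isCompact_sphere 0 1).eventually_forall_of_forall_eventually fun u₀ hu₀ => ?_
    have hu : u₀ ≠ 0 := ne_zero_of_mem_unit_sphere ⟨u₀, hu₀⟩
    have h2 : ∀ᶠ r : Param n d × Euc d in 𝓝 (x₀, u₀), ∀ i,
        (0 < inner ℝ u₀ (x₀.1 i) → 0 < inner ℝ r.2 (r.1.1 i)) ∧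
        (inner ℝ u₀ (x₀.1 i) < 0 → inner ℝ r.2 (r.1.1 i) < 0) := by
      rw [eventually_all]
      intro i
      have h3 : Continuous fun r : Param n d × Euc d => (inner ℝ r.2 (r.1.1 i) : ℝ) := by fun_prop
      have h4 := h3.tendsto (x₀, u₀)
      rcases lt_trichotomy (inner ℝ u₀ (x₀.1 i)) 0 with hi | hi | hi
      · filter_upwards [h4.eventually_lt_const hi] with r hr
        exact ⟨fun h => absurd h hi.not_gt, fun _ => hr⟩
      · simp [hi]
      · filter_upwards [h4.eventually_const_lt hi] with r hr
        exact ⟨fun _ => hr, fun h => absurd h hi.not_gt⟩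
    filter_upwards [h2] with r hr
    obtain ⟨x, u⟩ := r
    simp only at hr ⊢
    obtain ⟨t, ht, htc, h01⟩ := exists_compat x u
    -- Strict signs at `(x₀, u₀)` persist nearby, so a maximizer for `(x, u)` is also one for `(x₀,
    -- u₀)`, where products may only degenerate to zero.
    have htc₀ : Compat x₀ u₀ t := fun i => ⟨fun hi => (htc i).1 ((hr i).1 hi),
      fun hi => (htc i).2 ((hr i).2 hi)⟩
    obtain ⟨u', hu'⟩ := hx.exists_strictCompat hu htc₀
    refine ⟨affMap x₀ t, hu'.affMap_mem_vert ht h01, ?_⟩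
    rw [pushforward_affMap (hx.lift_eq_singleton hu ht htc₀), htc.inner_eq ht]
  have hne : (vert (zonotope x₀)).Nonempty := by
    rw [← convexHull_nonempty_iff (𝕜 := ℝ), hZ.convexHull_vert]
    exact hZ.nonempty
  filter_upwards [h1] with x h1 z hz
  by_contra hn
  obtain ⟨u, hu, h2⟩ := exists_unit_inner_gt (convex_convexHull ℝ _)
    ((hZ.finite_vert.image _).isClosed_convexHull ℝ) (hne.image _).convexHull hn
  obtain ⟨q, hq, h3⟩ := h1 u hu
  have h4 := h2 _ (subset_convexHull ℝ _ (Set.mem_image_of_mem _ hq))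
  exact ((inner_le_support hz u).trans h3).not_gt h4

/-- The chosen lift does not involve `x`, so the pushforward of a fixed point is affine in the
parameters; uniqueness of the lift is not needed. -/
lemma exists_pushforward_eq {x₀ : Param n d} {q : Euc d} (hq : q ∈ zonotope x₀) :
    ∃ t ∈ cube n, affMap x₀ t = q ∧ ∀ x, pushforward x₀ x q = affMap x t := by
  obtain ⟨t, ht, rfl⟩ := hq
  have h := Classical.epsilon_spec (p := fun s => s ∈ lift x₀ (affMap x₀ t)) ⟨t, ht, rfl⟩
  exact ⟨_, h.1, h.2, fun x => rfl⟩

/-! ### Faces and their pushforwards -/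

lemma StrictCompat.minFace_eq {x : Param n d} {v : Euc d} {t : Fin n → ℝ}
    (h : StrictCompat x v t) (ht : t ∈ cube n) :
    minFace (zonotope x) (affMap x t) = affMap x '' cubeFace t := by
  have htc := (h.compat_iff ht).2 (mem_cubeFace_self ht)
  have hF : affMap x '' cubeFace t = {z ∈ zonotope x | inner ℝ v (z - affMap x t) = 0} := by
    ext z
    constructor
    · rintro ⟨s, hs, rfl⟩
      refine ⟨⟨s, hs.1, rfl⟩, ?_⟩
      rw [inner_sub_right, htc.inner_eq ht, ((h.compat_iff hs.1).2 hs).inner_eq hs.1, sub_self]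
    · rintro ⟨⟨s, hs, rfl⟩, h0⟩
      rw [inner_sub_right, htc.inner_eq ht, sub_eq_zero] at h0
      exact ⟨s, (h.compat_iff hs).1 ((support_le_inner_affMap_iff hs).1 h0.ge), rfl⟩
  apply ZonotopeHausdorff.minFace_eq
  · rw [hF]
    exact isExposed_setOf_inner_eq_zero ⟨t, ht, rfl⟩ ((mem_normalCone_zonotope_iff ht).2 htc)
  · exact ⟨t, mem_cubeFace_self ht, rfl⟩
  · rintro B hB hyB _ ⟨s, hs, rfl⟩
    obtain ⟨l, rfl⟩ := hB ⟨_, hyB⟩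
    refine ⟨⟨s, hs.1, rfl⟩, fun z hz => (hyB.2 z hz).trans ?_⟩
    set u := (InnerProductSpace.toDual ℝ (Euc d)).symm l with hu
    have hl : ∀ z, l z = inner ℝ u z := fun z => by rw [hu, InnerProductSpace.toDual_symm_apply]
    -- Any functional maximal at the image of `t` is compatible with `t`, hence maximal on the whole
    -- image of its cube face.
    have hc : Compat x u t := by
      rw [← mem_normalCone_zonotope_iff ht]
      intro z hz
      rw [inner_sub_right, sub_nonpos, ← hl, ← hl]
      exact hyB.2 z hz
    rw [hl, hl, hc.inner_eq ht, (hc.of_mem_cubeFace hs).inner_eq hs.1]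

/-- Every cube point over the face gives `v` its maximum and therefore lies in `cubeFace t`. -/
lemma StrictCompat.pushforwardSet_eq {x₀ : Param n d} {v : Euc d} {t : Fin n → ℝ}
    (h : StrictCompat x₀ v t) (x : Param n d) :
    pushforwardSet x₀ x (affMap x₀ '' cubeFace t) = affMap x '' cubeFace t := by
  rw [pushforwardSet]
  congr 1
  ext s
  simp only [Set.mem_iUnion, exists_prop]
  constructor
  · rintro ⟨_, ⟨r, hr, rfl⟩, hs, hsr⟩
    rw [← h.compat_iff hs, ← support_le_inner_affMap_iff hs, hsr,
      ((h.compat_iff hr.1).2 hr).inner_eq hr.1]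
  · exact fun hs => ⟨_, ⟨s, hs, rfl⟩, hs.1, rfl⟩

lemma pushforwardSet_zonotope (x₀ x : Param n d) :
    pushforwardSet x₀ x (zonotope x₀) = zonotope x := by
  rw [pushforwardSet, zonotope, zonotope]
  congr 1
  ext s
  simp only [Set.mem_iUnion, exists_prop]
  exact ⟨fun ⟨_, _, hs, _⟩ => hs, fun hs => ⟨_, ⟨s, hs, rfl⟩, hs, rfl⟩⟩

/-- A stable point outside of the interior lies over the relative interior of a face of the
zonotope. -/
lemma GeneralPosition.exists_strictCompat_of_stable {x : Param n d} (hx : GeneralPosition x)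
    {p : Euc d} (hp : HausdorffStable (zonotope x) p) (hint : p ∉ interior (zonotope x)) :
    ∃ t ∈ cube n, affMap x t = proj (zonotope x) p ∧
      StrictCompat x (p - proj (zonotope x) p) t ∧
      LinearIndependent ℝ fun i : {i // t i ≠ 0 ∧ t i ≠ 1} => x.1 i := by
  have hZ := isPolytope_zonotope x
  have hproj := (proj_spec hZ.isCompact hZ.nonempty p).1
  have hv := hp.resolve_left hint
  obtain ⟨t, ht, hty⟩ := hproj
  rw [← hty] at hv ⊢
  have hvc := (mem_normalCone_zonotope_iff ht).1 (intrinsicInterior_subset hv)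
  -- The difference vector itself may be zero when `p` lies in the zonotope; then another normal is
  -- used to apply general position.
  have hu : ∃ u, u ≠ 0 ∧ Compat x u t := by
    by_cases h0 : p - affMap x t = 0
    · obtain ⟨u, hu, hle⟩ := exists_support_le_inner_of_notMem_interior hint
      rw [sub_eq_zero.1 h0] at hle
      exact ⟨u, hu, (support_le_inner_affMap_iff ht).1 hle⟩
    · exact ⟨_, h0, hvc⟩
  obtain ⟨u, hu, huc⟩ := hu
  have hli := hx.linearIndependent hu (p := fun i => t i ≠ 0 ∧ t i ≠ 1) fun i hi => by
    rcases lt_trichotomy (inner ℝ u (x.1 i)) 0 with h | h | h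
    · exact absurd ((huc i).2 h) hi.1
    · exact h
    · exact absurd ((huc i).1 h) hi.2
  obtain ⟨u', hu'⟩ := hx.exists_strictCompat hu huc
  have huN := (mem_normalCone_zonotope_iff ht).2 ((hu'.compat_iff ht).2 (mem_cubeFace_self ht))
  -- Moving the difference vector slightly away from the strictly compatible `u'` stays in the
  -- normal cone, so it must have the strict signs of `u'` already.
  obtain ⟨ε, hε, hN⟩ := exists_add_smul_mem_of_mem_intrinsicInterior hv huN
  rw [mem_normalCone_zonotope_iff ht] at hN
  refine ⟨t, ht, rfl, fun i => ?_, hli⟩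
  have hNi := hN i
  rw [inner_add_left, inner_smul_left, inner_sub_left (p - affMap x t), conj_trivial] at hNi
  set a := inner ℝ (p - affMap x t) (x.1 i)
  set c := inner ℝ u' (x.1 i) with hc
  have hci := hu' i
  rw [← hc] at hci
  refine ⟨fun h1 => ?_, fun h0 => ?_, fun h0 h1 => ?_⟩
  · have h2 : 0 ≤ a + ε * (a - c) := by
      by_contra! h
      have := hNi.2 h
      linarith
    nlinarith [mul_pos hε (hci.1 h1)]
  · have h2 : a + ε * (a - c) ≤ 0 := by
      by_contra! h
      have := hNi.1 h
      linarith
    nlinarith [mul_pos hε (neg_pos.2 (hci.2.1 h0))]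
  · rcases lt_trichotomy a 0 with h | h | h
    · exact absurd ((hvc i).2 h) h0
    · exact h
    · exact absurd ((hvc i).1 h) h1

/-- Near `x₀` the distance of a stable point outside of the interior to the zonotope is the distance
to the affine span of the pushforward of a face, and it is the norm of a residual. -/
lemma GeneralPosition.exists_infDist_eq {x₀ : Param n d} (hx : GeneralPosition x₀) {p : Euc d}
    (hp : HausdorffStable (zonotope x₀) p) (hint : p ∉ interior (zonotope x₀)) :
    ∃ t : Fin n → ℝ, ∀ᶠ x in 𝓝 x₀,
      (Matrix.gram ℝ fun i : {i // t i ≠ 0 ∧ t i ≠ 1} => x.1 i).det ≠ 0 ∧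
      Metric.infDist p (zonotope x) =
        ‖residual (fun i : {i // t i ≠ 0 ∧ t i ≠ 1} => x.1 i) (p - affMap x t)‖ ∧
      termOfP x₀ p x =
        ‖residual (fun i : {i // t i ≠ 0 ∧ t i ≠ 1} => x.1 i) (p - affMap x t)‖ := by
  obtain ⟨t, ht, hty, hstrict, hli⟩ := hx.exists_strictCompat_of_stable hp hint
  rw [← hty] at hstrict
  refine ⟨t, ?_⟩
  let b : Param n d → {i // t i ≠ 0 ∧ t i ≠ 1} → Euc d := fun x i => x.1 i
  let w : Param n d → Euc d := fun x => p - affMap x t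
  have hb : Continuous b := by fun_prop
  have hw : Continuous w := continuous_const.sub (continuous_affMap_param t)
  have hdet : (Matrix.gram ℝ (b x₀)).det ≠ 0 :=
    Matrix.det_gram_ne_zero_iff_linearIndependent.2 hli
  have horth : ∀ i, inner ℝ (b x₀ i) (w x₀) = 0 := fun i => by
    rw [real_inner_comm]
    exact (hstrict i).2.2 i.2.1 i.2.2
  have hc : Tendsto (fun x => gramCoeff (b x) (w x)) (𝓝 x₀) (𝓝 0) := by
    have h1 := (continuousAt_gramCoeff hb hw hdet).tendsto
    rwa [gramCoeff_eq_zero horth] at h1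
  have hr : Tendsto (fun x => residual (b x) (w x)) (𝓝 x₀) (𝓝 (w x₀)) := by
    have h1 := (continuousAt_residual hb hw hdet).tendsto
    rwa [residual_eq_self horth] at h1
  have hdet' := eventually_det_gram_ne_zero hb hdet
  have hsc : ∀ᶠ x in 𝓝 x₀, StrictCompat x (residual (b x) (w x)) t := by
    simp only [StrictCompat]
    rw [eventually_all]
    intro i
    have hxi : Tendsto (fun x : Param n d => x.1 i) (𝓝 x₀) (𝓝 (x₀.1 i)) := by
      have : Continuous fun x : Param n d => x.1 i := by fun_prop
      exact this.tendsto x₀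
    have hi' := Tendsto.inner (𝕜 := ℝ) hr hxi
    by_cases h0 : t i = 0
    · filter_upwards [hi'.eventually_lt_const ((hstrict i).2.1 h0)] with x hx
      simp [h0, hx]
    · by_cases h1 : t i = 1
      · filter_upwards [hi'.eventually_const_lt ((hstrict i).1 h1)] with x hx
        simp [h1, hx]
      · filter_upwards [hdet'] with x hx
        simp only [h0, h1, false_imp_iff, true_and, not_false_eq_true, ne_eq, true_imp_iff]
        exact inner_residual hx (w x) ⟨i, h0, h1⟩
  -- A lift of the foot of the perpendicular: only coordinates strictly between 0 and 1 move, by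
  -- small amounts, so `s x` stays in the cube face.
  let s : Param n d → Fin n → ℝ := fun x i =>
    t i + if h : t i ≠ 0 ∧ t i ≠ 1 then gramCoeff (b x) (w x) ⟨i, h⟩ else 0
  have hs : ∀ᶠ x in 𝓝 x₀, s x ∈ cubeFace t := by
    have h1 : ∀ᶠ x in 𝓝 x₀, ∀ i, 0 ≤ s x i ∧ s x i ≤ 1 := by
      rw [eventually_all]
      intro i
      by_cases hi : t i ≠ 0 ∧ t i ≠ 1
      · simp only [s, dif_pos hi]
        have h2 : Tendsto (fun x => t i + gramCoeff (b x) (w x) ⟨i, hi⟩) (𝓝 x₀) (𝓝 (t i)) := by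
          simpa using (tendsto_pi_nhds.1 hc ⟨i, hi⟩).const_add (t i)
        filter_upwards [h2.eventually_const_lt (lt_of_le_of_ne (ht.1 i) hi.1.symm),
          h2.eventually_lt_const (lt_of_le_of_ne (ht.2 i) hi.2)] with x h3 h4
        exact ⟨h3.le, h4.le⟩
      · simp only [s, dif_neg hi, add_zero]
        exact Eventually.of_forall fun x => ⟨ht.1 i, ht.2 i⟩
    filter_upwards [h1] with x hx
    refine ⟨⟨fun i => (hx i).1, fun i => (hx i).2⟩, fun i hi => ?_⟩
    have hi' : ¬(t i ≠ 0 ∧ t i ≠ 1) := by tauto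
    simp only [s, dif_neg hi', add_zero]
  have hres : ∀ x, residual (b x) (w x) = p - affMap x (s x) := fun x => by
    have h1 : affMap x (s x) = affMap x t + ∑ i, gramCoeff (b x) (w x) i • b x i := by
      have h2 : ∑ i, gramCoeff (b x) (w x) i • b x i =
          ∑ i, (if h : t i ≠ 0 ∧ t i ≠ 1 then gramCoeff (b x) (w x) ⟨i, h⟩ else 0) • x.1 i := by
        rw [← sum_subtype_eq_sum (p := fun i => t i ≠ 0 ∧ t i ≠ 1) fun i hi => by
          rw [dif_neg hi, zero_smul]]
        exact Finset.sum_congr rfl fun i _ => by rw [dif_pos i.2]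
      rw [h2]
      simp only [affMap, s, add_smul, Finset.sum_add_distrib]
      abel
    rw [h1, residual, sub_sub]
  have hface : projFace (zonotope x₀) p = affMap x₀ '' cubeFace t := by
    rw [projFace, ← hty, hstrict.minFace_eq ht]
  filter_upwards [hdet', hsc, hs] with x h1 h2 h3
  have h4 := (h2.compat_iff h3.1).2 h3
  rw [hres] at h2 h4
  refine ⟨h1, ?_, ?_⟩
  · change _ = ‖residual (b x) (w x)‖
    rw [hres]
    exact infDist_eq_of_inner_nonpos ⟨s x, h3.1, rfl⟩ ((mem_normalCone_zonotope_iff h3.1).2 h4)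
  · change _ = ‖residual (b x) (w x)‖
    rw [hres, termOfP, hface, hstrict.pushforwardSet_eq, distAff]
    refine infDist_affineSpan_eq (subset_affineSpan ℝ _ ⟨s x, h3, rfl⟩) ?_
    rintro _ ⟨r, hr, rfl⟩
    rw [inner_sub_right, h4.inner_eq h3.1, ((h2.compat_iff hr.1).2 hr).inner_eq hr.1, sub_self]

/-- Here `F_p` is all of `Z₀`, and its pushforward, the nearby zonotope, still contains `p`. -/
lemma eventually_termOfP_eq_zero {x₀ : Param n d} {p : Euc d}
    (hp : p ∈ interior (zonotope x₀)) :
    ∀ᶠ x in 𝓝 x₀, Metric.infDist p (zonotope x) = 0 ∧ termOfP x₀ p x = 0 := by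
  filter_upwards [eventually_mem_zonotope_of_mem_interior hp] with x hx
  refine ⟨Metric.infDist_zero_of_mem hx, ?_⟩
  rw [termOfP, projFace, proj_eq_self (isPolytope_zonotope x₀).isCompact (interior_subset hp),
    minFace_of_mem_interior hp, pushforwardSet_zonotope]
  exact Metric.infDist_zero_of_mem (subset_affineSpan ℝ _ hx)

/-- Otherwise zero is in the relative interior of the normal cone, so a negative multiple of a
nonzero normal is normal too. The normal is then maximal at an interior point, which is impossible.
-/
lemma mem_interior_zonotope_of_stable {x : Param n d} {p : Euc d}
    (hp : HausdorffStable (zonotope x) p) (hpZ : p ∈ zonotope x)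
    (hne : (interior (zonotope x)).Nonempty) : p ∈ interior (zonotope x) := by
  by_contra hint
  have hv := hp.resolve_left hint
  rw [proj_eq_self (isPolytope_zonotope x).isCompact hpZ, sub_self] at hv
  obtain ⟨u, hu, hle⟩ := exists_support_le_inner_of_notMem_interior hint
  have huN : u ∈ normalCone (zonotope x) p := fun z hz => by
    rw [inner_sub_right, sub_nonpos]
    exact (inner_le_support hz u).trans hle
  obtain ⟨ε, hε, hN⟩ := exists_add_smul_mem_of_mem_intrinsicInterior hv huN
  obtain ⟨z₀, hz₀⟩ := hne
  have h1 := hN z₀ (interior_subset hz₀)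
  rw [zero_add, zero_sub, smul_neg, inner_neg_left, inner_smul_left, conj_trivial,
    inner_sub_right] at h1
  have h2 : inner ℝ u p ≤ inner ℝ u z₀ := by
    by_contra! h
    nlinarith [mul_pos hε (sub_pos.2 h)]
  exact hu (eq_zero_of_isMax_of_mem_interior hz₀ fun z hz =>
    ((inner_le_support hz u).trans hle).trans h2)

/-! ### The Hausdorff distance of polytopes -/

/-- The Hausdorff distance of two convex sets is the largest distance of a vertex of one of them to
the other one. -/
lemma isGreatest_hausdorffDist {P Z A B : Set (Euc d)} (hP : Convex ℝ P) (hZ : Convex ℝ Z)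
    (hPne : P.Nonempty) (hZne : Z.Nonempty) (hPb : Bornology.IsBounded P)
    (hZb : Bornology.IsBounded Z) (hA : A.Finite) (hB : B.Finite) (hAP : A ⊆ P) (hBZ : B ⊆ Z)
    (hPA : P ⊆ convexHull ℝ A) (hZB : Z ⊆ convexHull ℝ B) :
    IsGreatest ((fun p => Metric.infDist p Z) '' A ∪ (fun q => Metric.infDist q P) '' B)
      (Metric.hausdorffDist P Z) := by
  have hfin := (hA.image fun p => Metric.infDist p Z).union (hB.image fun q => Metric.infDist q P)
  have hAne : A.Nonempty := convexHull_nonempty_iff.1 (hPne.mono hPA)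
  obtain ⟨M, hM, hmax⟩ := hfin.isCompact.exists_isGreatest ((hAne.image _).inl)
  have hPZ := Metric.hausdorffEDist_ne_top_of_nonempty_of_bounded hPne hZne hPb hZb
  have hZP := Metric.hausdorffEDist_ne_top_of_nonempty_of_bounded hZne hPne hZb hPb
  have hM0 : 0 ≤ M := by
    rcases hM with ⟨p, -, rfl⟩ | ⟨q, -, rfl⟩ <;> exact Metric.infDist_nonneg
  have hle : M ≤ Metric.hausdorffDist P Z := by
    rcases hM with ⟨p, hp, rfl⟩ | ⟨q, hq, rfl⟩
    · exact Metric.infDist_le_hausdorffDist_of_mem (hAP hp) hPZ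
    · rw [Metric.hausdorffDist_comm]
      exact Metric.infDist_le_hausdorffDist_of_mem (hBZ hq) hZP
  have hge : Metric.hausdorffDist P Z ≤ M := by
    refine Metric.hausdorffDist_le_of_infDist hM0 (fun p hp => ?_) fun q hq => ?_
    · exact infDist_le_of_mem_convexHull hZ hZne
        (fun a ha => hmax (Or.inl (Set.mem_image_of_mem _ ha))) (hPA hp)
    · exact infDist_le_of_mem_convexHull hP hPne
        (fun b hb => hmax (Or.inr (Set.mem_image_of_mem _ hb))) (hZB hq)
  rw [le_antisymm hge hle]
  exact ⟨hM, hmax⟩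

/-! ### The terms of the maximum -/

/-- The coordinates of `Q t + μ`, as polynomials in the entries of `Q` and `μ`. -/
noncomputable def affPoly (t : Fin n → ℝ) (k : Fin d) : MvPolynomial ((Fin n × Fin d) ⊕ Fin d) ℝ :=
  ∑ i, MvPolynomial.C (t i) * MvPolynomial.X (Sum.inl (i, k)) + MvPolynomial.X (Sum.inr k)

lemma eval_affPoly (t : Fin n → ℝ) (x : Param n d) (k : Fin d) :
    MvPolynomial.eval (coords x) (affPoly t k) = affMap x t k := by
  simp [affPoly, affMap, coords]

/-- Needed separately, because the square root argument gives no differentiability at a zero value.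
-/
lemma regular_of_eventually_eq_zero {f : Param n d → ℝ} {x₀ : Param n d}
    (h : ∀ᶠ x in 𝓝 x₀, f x = 0) :
    (∀ᶠ V in (𝓝 x₀).smallSets, IsSqrtOfBoundedRational f V) ∧
      ∀ᶠ V in (𝓝 x₀).smallSets, DifferentiableOn ℝ f V := by
  refine ⟨(regular_of_sq_eq_rational (N := 0) (D := 1) ?_).1, ?_⟩
  · filter_upwards [h] with x hx
    simp [hx]
  · exact eventually_smallSets.2 ⟨_, h, fun V hV =>
      (differentiableOn_const (0 : ℝ)).congr fun x hx => hV hx⟩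

/-- The term of a stable vertex of the polytope `P`. -/
lemma GeneralPosition.termOfP_regular {x₀ : Param n d} (hx : GeneralPosition x₀) {p : Euc d}
    (hp : HausdorffStable (zonotope x₀) p) :
    (∀ᶠ x in 𝓝 x₀, termOfP x₀ p x = Metric.infDist p (zonotope x)) ∧
      (∀ᶠ V in (𝓝 x₀).smallSets, IsSqrtOfBoundedRational (termOfP x₀ p) V) ∧
      (p ∉ zonotope x₀ ∨ (interior (zonotope x₀)).Nonempty →
        ∀ᶠ V in (𝓝 x₀).smallSets, DifferentiableOn ℝ (termOfP x₀ p) V) := by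
  by_cases hint : p ∈ interior (zonotope x₀)
  · have h := eventually_termOfP_eq_zero hint
    have h' := regular_of_eventually_eq_zero (h.mono fun x hx => hx.2)
    exact ⟨h.mono fun x hx => hx.2.trans hx.1.symm, h'.1, fun _ => h'.2⟩
  · obtain ⟨t, ht⟩ := hx.exists_infDist_eq hp hint
    obtain ⟨N, D, hND⟩ := exists_rational_norm_residual_sq
      (b := fun (x : Param n d) (i : {i // t i ≠ 0 ∧ t i ≠ 1}) => x.1 i)
      (w := fun x => p - affMap x t)
      (fun i k => MvPolynomial.X (Sum.inl (i.1, k))) (fun k => MvPolynomial.C (p k) - affPoly t k)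
      (fun x i k => by simp [coords]) (fun x k => by simp [eval_affPoly])
    have hreg : ∀ᶠ x in 𝓝 x₀, MvPolynomial.eval (coords x) D ≠ 0 ∧ 0 ≤ termOfP x₀ p x ∧
        termOfP x₀ p x ^ 2 = MvPolynomial.eval (coords x) N / MvPolynomial.eval (coords x) D := by
      filter_upwards [ht] with x hx
      exact ⟨(hND x hx.1).1, Metric.infDist_nonneg, by rw [hx.2.2, (hND x hx.1).2]⟩
    have hdist : ∀ᶠ x in 𝓝 x₀, termOfP x₀ p x = Metric.infDist p (zonotope x) :=
      ht.mono fun x hx => hx.2.2.trans hx.2.1.symm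
    obtain ⟨h1, h2⟩ := regular_of_sq_eq_rational hreg
    refine ⟨hdist, h1, fun hor => h2 ?_⟩
    have hpZ : p ∉ zonotope x₀ := fun hpZ =>
      hint (mem_interior_zonotope_of_stable hp hpZ (hor.resolve_left (not_not.2 hpZ)))
    have hZ := isPolytope_zonotope x₀
    rw [hdist.self_of_nhds]
    exact ((hZ.isCompact.isClosed.notMem_iff_infDist_pos hZ.nonempty).1 hpZ).ne'

/-- The term of a vertex of the zonotope that is stable relative to the polytope `P`. -/
lemma HausdorffStable.termOfZ_regular {P : Set (Euc d)} (hP : IsPolytope P) {x₀ : Param n d}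
    {q : Euc d} (hq : HausdorffStable P q) (hqZ : q ∈ zonotope x₀) :
    (∀ᶠ x in 𝓝 x₀, termOfZ P x₀ q x = Metric.infDist (pushforward x₀ x q) P) ∧
      (∀ᶠ V in (𝓝 x₀).smallSets, IsSqrtOfBoundedRational (termOfZ P x₀ q) V) ∧
      (q ∉ P ∨ (interior P).Nonempty →
        ∀ᶠ V in (𝓝 x₀).smallSets, DifferentiableOn ℝ (termOfZ P x₀ q) V) := by
  obtain ⟨t, ht, htq, hpush⟩ := exists_pushforward_eq hqZ
  obtain ⟨k, b, y, hdet, hev⟩ := hq.exists_infDist_eq hP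
  have htend : Tendsto (fun x => pushforward x₀ x q) (𝓝 x₀) (𝓝 q) := by
    simp only [hpush]
    have h := (continuous_affMap_param (d := d) t).tendsto x₀
    rwa [htq] at h
  have hev' := htend.eventually hev
  obtain ⟨N, D, hND⟩ := exists_rational_norm_residual_sq (b := fun _ : Param n d => b)
    (w := fun x => affMap x t - y)
    (fun i k => MvPolynomial.C (b i k)) (fun k => affPoly t k - MvPolynomial.C (y k))
    (fun x i k => by simp) (fun x k => by simp [eval_affPoly])
  have hreg : ∀ᶠ x in 𝓝 x₀, MvPolynomial.eval (coords x) D ≠ 0 ∧ 0 ≤ termOfZ P x₀ q x ∧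
      termOfZ P x₀ q x ^ 2 = MvPolynomial.eval (coords x) N / MvPolynomial.eval (coords x) D := by
    filter_upwards [hev'] with x hx
    refine ⟨(hND x hdet).1, Metric.infDist_nonneg, ?_⟩
    rw [termOfZ, hx.2, hpush, (hND x hdet).2]
  have hdist : ∀ᶠ x in 𝓝 x₀, termOfZ P x₀ q x = Metric.infDist (pushforward x₀ x q) P :=
    hev'.mono fun x hx => hx.2.trans hx.1.symm
  obtain ⟨h1, h2⟩ := regular_of_sq_eq_rational hreg
  refine ⟨hdist, h1, fun hor => ?_⟩
  by_cases hqP : q ∈ P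
  · exact (regular_of_eventually_eq_zero (Eventually.of_forall fun x =>
      hq.distAff_eq_zero hP hqP (hor.resolve_left (not_not.2 hqP)) _)).2
  · apply h2
    rw [hdist.self_of_nhds, hpush, htq]
    exact ((hP.isCompact.isClosed.notMem_iff_infDist_pos hP.nonempty).1 hqP).ne'

/-! ### Permutations of the generators -/

lemma mk_eq_mk_iff {x y : Param n d} :
    ZonotopeSpace.mk x = ZonotopeSpace.mk y ↔ ∃ σ : Equiv.Perm (Fin n), y = (x.1 ∘ σ, x.2) :=
  Quotient.eq (r := permSetoid n d)

/-- The saturation of `V` is the union of its preimages under the permutations. -/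
lemma isOpen_image_mk {V : Set (Param n d)} (hV : IsOpen V) :
    IsOpen (ZonotopeSpace.mk '' V) := by
  change IsOpen (ZonotopeSpace.mk ⁻¹' (ZonotopeSpace.mk '' V))
  have h : ZonotopeSpace.mk ⁻¹' (ZonotopeSpace.mk '' V) =
      ⋃ σ : Equiv.Perm (Fin n), (fun x : Param n d => (x.1 ∘ σ, x.2)) ⁻¹' V := by
    ext x
    simp only [Set.mem_preimage, Set.mem_image, Set.mem_iUnion]
    constructor
    · rintro ⟨y, hy, h⟩
      obtain ⟨σ, rfl⟩ := mk_eq_mk_iff.1 h.symm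
      exact ⟨σ, hy⟩
    · rintro ⟨σ, hσ⟩
      exact ⟨_, hσ, (mk_eq_mk_iff.2 ⟨σ, rfl⟩).symm⟩
  rw [h]
  refine isOpen_iUnion fun σ => hV.preimage ?_
  simp only [Function.comp_def]
  fun_prop

lemma affMap_comp_perm (x : Param n d) (σ : Equiv.Perm (Fin n)) (t : Fin n → ℝ) :
    affMap (x.1 ∘ σ, x.2) (t ∘ σ) = affMap x t := by
  simp only [affMap, Function.comp_apply]
  rw [Equiv.sum_comp σ fun i => t i • x.1 i]

/-- Parameters near `x₀` that are related by a permutation are related by a permutation that fixes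
`x₀`. -/
lemma eventually_perm_fixes (x₀ : Param n d) :
    ∀ᶠ p in 𝓝 x₀ ×ˢ 𝓝 x₀, ∀ σ : Equiv.Perm (Fin n),
      p.2 = (p.1.1 ∘ σ, p.1.2) → (x₀.1 ∘ σ, x₀.2) = x₀ := by
  rw [eventually_all]
  intro σ
  by_cases hσ : (x₀.1 ∘ σ, x₀.2) = x₀
  · simp [hσ]
  · have hc : Continuous fun p : Param n d × Param n d =>
        (((p.1.1 ∘ σ, p.1.2) : Param n d), p.2) := by
      simp only [Function.comp_def]
      fun_prop
    -- If `σ` moves `x₀`, then permuted parameters near `x₀` stay apart from parameters near `x₀`.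
    have h : ∀ᶠ p : Param n d × Param n d in 𝓝 (x₀, x₀), (p.1.1 ∘ σ, p.1.2) ≠ p.2 :=
      (isOpen_ne_fun hc.fst hc.snd).mem_nhds hσ
    rw [← nhds_prod_eq]
    filter_upwards [h] with p hp hp'
    exact absurd hp'.symm hp

/-- The pushforward of a stable point is invariant under permutations that fix `x₀`. -/
lemma StablePoint.pushforward_comp_perm {x₀ : Param n d} {q : Euc d} (hq : StablePoint x₀ q)
    {σ : Equiv.Perm (Fin n)} (hσ : (x₀.1 ∘ σ, x₀.2) = x₀) (x : Param n d) :
    pushforward x₀ (x.1 ∘ σ, x.2) q = pushforward x₀ x q := by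
  obtain ⟨t, ht⟩ := hq
  have htq : t ∈ lift x₀ q := ht ▸ rfl
  obtain ⟨htc, rfl⟩ := htq
  -- Since `σ` fixes `x₀`, permuting the lift gives a lift of the same point, so uniqueness forces
  -- `t ∘ σ = t`.
  have hts : t ∘ σ ∈ lift x₀ (affMap x₀ t) := by
    refine ⟨⟨fun i => htc.1 (σ i), fun i => htc.2 (σ i)⟩, ?_⟩
    have h := affMap_comp_perm x₀ σ t
    rwa [hσ] at h
  rw [ht] at hts
  rw [pushforward_affMap ht, pushforward_affMap ht, ← affMap_comp_perm x σ t,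
    show t ∘ σ = t from hts]

end ZonotopeHausdorff

/-! ### The main theorem -/

theorem mainTheorem1 (n d : ℕ) (P : Set (Euc d)) (hP : IsPolytope P) (x₀ : Param n d)
    (hloc : LocalityConditions P x₀) :
    ∃ (U : Set (ZonotopeSpace n d)) (V : Set (Param n d)),
      -- `U` is an open neighbourhood of `Z₀`, parametrized by the open set `V`
      IsOpen U ∧ ZonotopeSpace.mk x₀ ∈ U ∧ IsOpen V ∧ x₀ ∈ V ∧ ZonotopeSpace.mk '' V = U ∧
      -- the pushforward `∂Z₀ → ∂Z` is well defined and depends only on `Z ∈ U`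
      (∀ q ∈ frontier (zonotope x₀), StablePoint x₀ q) ∧
      (∀ x ∈ V, Set.MapsTo (pushforward x₀ x) (frontier (zonotope x₀)) (frontier (zonotope x))) ∧
      (∀ x ∈ V, ∀ y ∈ V, ZonotopeSpace.mk x = ZonotopeSpace.mk y →
        Set.EqOn (pushforward x₀ x) (pushforward x₀ y) (frontier (zonotope x₀))) ∧
      -- the formula for the Hausdorff distance as a maximum
      (∀ x ∈ V, IsGreatest
        ((fun p => termOfP x₀ p x) '' vert P ∪ (fun q => termOfZ P x₀ q x) '' vert (zonotope x₀))
        (hausdorffTo P (ZonotopeSpace.mk x))) ∧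
      -- the regularity of the terms of the maximum
      (∀ p ∈ vert P, IsSqrtOfBoundedRational (termOfP x₀ p) V ∧
        (p ∉ zonotope x₀ ∨ (interior (zonotope x₀)).Nonempty →
          DifferentiableOn ℝ (termOfP x₀ p) V)) ∧
      (∀ q ∈ vert (zonotope x₀), IsSqrtOfBoundedRational (termOfZ P x₀ q) V ∧
        (q ∉ P ∨ (interior P).Nonempty → DifferentiableOn ℝ (termOfZ P x₀ q) V)) := by
  have hgp := hloc.generalPosition
  have hZ₀ := isPolytope_zonotope x₀
  have hvertZ : vert (zonotope x₀) ⊆ zonotope x₀ := extremePoints_subset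
  have hstab : ∀ q ∈ frontier (zonotope x₀), StablePoint x₀ q := fun q hq => hgp.stablePoint hq
  have hregP := fun p hp => hgp.termOfP_regular (hloc.stable_left p hp)
  have hregZ := fun q hq => (hloc.stable_right q hq).termOfZ_regular hP (hvertZ hq)
  have hdistP : ∀ᶠ x in 𝓝 x₀, ∀ p ∈ vert P, termOfP x₀ p x = Metric.infDist p (zonotope x) :=
    hP.finite_vert.eventually_all.2 fun p hp => (hregP p hp).1
  have hdistZ : ∀ᶠ x in 𝓝 x₀, ∀ q ∈ vert (zonotope x₀),
      termOfZ P x₀ q x = Metric.infDist (pushforward x₀ x q) P :=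
    hZ₀.finite_vert.eventually_all.2 fun q hq => (hregZ q hq).1
  -- All local statements are phrased for small sets, so that finitely many of them hold on one
  -- common `V`.
  have hpoint := eventually_smallSets_forall.2
    (hgp.eventually_mapsTo_frontier.and (hgp.eventually_zonotope_subset.and (hdistP.and hdistZ)))
  have hsetP : ∀ᶠ V in (𝓝 x₀).smallSets, ∀ p ∈ vert P, IsSqrtOfBoundedRational (termOfP x₀ p) V ∧
      (p ∉ zonotope x₀ ∨ (interior (zonotope x₀)).Nonempty →
        DifferentiableOn ℝ (termOfP x₀ p) V) :=
    hP.finite_vert.eventually_all.2 fun p hp =>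
      (hregP p hp).2.1.and (eventually_imp_distrib_left.2 (hregP p hp).2.2)
  have hsetZ : ∀ᶠ V in (𝓝 x₀).smallSets, ∀ q ∈ vert (zonotope x₀),
      IsSqrtOfBoundedRational (termOfZ P x₀ q) V ∧
        (q ∉ P ∨ (interior P).Nonempty → DifferentiableOn ℝ (termOfZ P x₀ q) V) :=
    hZ₀.finite_vert.eventually_all.2 fun q hq =>
      (hregZ q hq).2.1.and (eventually_imp_distrib_left.2 (hregZ q hq).2.2)
  obtain ⟨A, hA, hperm⟩ := eventually_prod_self_iff'.1 (eventually_perm_fixes x₀)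
  obtain ⟨B, hB, hall⟩ := eventually_smallSets.1 (hpoint.and (hsetP.and hsetZ))
  obtain ⟨V, hVAB, hV, hxV⟩ := mem_nhds_iff.1 (inter_mem hA hB)
  obtain ⟨hVpoint, hVP, hVZ⟩ := hall V (hVAB.trans Set.inter_subset_right)
  refine ⟨_, V, isOpen_image_mk hV, Set.mem_image_of_mem _ hxV, hV, hxV, rfl, hstab,
    fun x hx => (hVpoint x hx).1, fun x hx y hy hxy q hq => ?_, fun x hx => ?_, hVP, hVZ⟩
  · obtain ⟨σ, hσ⟩ := mk_eq_mk_iff.1 hxy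
    have hfix := hperm x (hVAB hx).1 y (hVAB hy).1 σ hσ
    rw [hσ, (hstab q hq).pushforward_comp_perm hfix]
  · obtain ⟨-, hsub, hp, hq⟩ := hVpoint x hx
    have hZ := isPolytope_zonotope x
    -- The pushforwards only have to lie in the nearby zonotope and span it; that they are its
    -- vertices is not needed.
    have hB : pushforward x₀ x '' vert (zonotope x₀) ⊆ zonotope x := by
      rintro _ ⟨q, hq, rfl⟩
      obtain ⟨t, ht, -, h⟩ := exists_pushforward_eq (hvertZ hq)
      exact ⟨t, ht, (h x).symm⟩
    have hmain := isGreatest_hausdorffDist hP.convex hZ.convex hP.nonempty hZ.nonempty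
      hP.isCompact.isBounded hZ.isCompact.isBounded hP.finite_vert (hZ₀.finite_vert.image _)
      extremePoints_subset hB hP.convexHull_vert.ge hsub
    rw [Set.image_image, ← Set.image_congr hp, ← Set.image_congr hq] at hmain
    exact hmain
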